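/- **Exponential de Finetti theorem.** Let $d,n\ge 1$ and $0\le r\le k\le n$ be integers, put $\delta = k(d+k)/n$, and assume $\delta<1/3$. Notation. For $m\ge 0$ let $\vee^m\mathbb{C}^d$ be the subspace of permutation-invariant vectors of $(\mathbb{C}^d)^{\otimes m}$, $\Pi_m$ the orthogonal projector onto it, and $d[m]=\binom{d+m-1}{m}$ its dimension. Let $\mathrm{tr}_{n-k}$ be the partial trace over the last $n-k$ of $n$ tensor factors $\mathbb{C}^d$. For $a\le b$ the optimal cloning map from operators on $(\mathbb{C}^d)^{\otimes a}$ to operators on $(\mathbb{C}^d)^{\otimes b}$ is $$\mathrm{Clone}_{a\to b}(\rho)=\frac{d[a]}{d[b]}\,\Pi_b\,(\rho\otimes I^{\otimes (b-a)})\,\Pi_b ,$$ and for $j\ge 0$ the optimal measure-and-prepare map from operators on $(\mathbb{C}^d)^{\otimes n}$ to operators on $(\mathbb{C}^d)^{\otimes j}$ is $$\mathrm{MP}_{n\to j}(\rho)=\mathrm{tr}_{1,\dots,n}\Big[d[n]\;\mathbb{E}_{\varphi}\big[(|\varphi\rangle\langle\varphi|)^{\otimes (n+j)}\big]\,(\rho\otimes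 I^{\otimes j})\Big],$$ where $\varphi$ is a uniformly random unit vector of $\mathbb{C}^d$ and the trace is over the first $n$ tensor factors. For a linear map $\Phi$ from operators on $(\mathbb{C}^d)^{\otimes n}$ to operators on $(\mathbb{C}^d)^{\otimes k}$, let $$\|\Phi|_{\vee^n\mathbb{C}^d}\|_\diamond=\sup_{m}\ \sup_{X}\ \|(\Phi\otimes \mathrm{id}_m)(X)\|_1$$ be the diamond norm of its restriction to operators on $\vee^n\mathbb{C}^d$; here $\|\cdot\|_1$ is the trace norm and $X$ runs over the operators on $\vee^n\mathbb{C}^d\otimes\mathbb{C}^m$ with $\|X\|_1\le 1$. Claim. There are real numbers $x_0,\dots,x_r$ such that $$|x_s|\le\frac{(2\delta)^s}{1-\delta}\qquad(0\le s\le r)$$ and $$\Big\|\Big(\mathrm{tr}_{n-k}-\sum_{s=0}^r x_s\,\mathrm{Clone}_{k-s\to k}\circ\mathrm{MP}_{n\to k-s}\Big)\Big|_{\vee^n\mathbb{C}^d}\Big\|_\diamond\ \le\ \frac{\delta^r}{1-3\delta}.$$ Here $0^0=1$. -/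

import Mathlib

open scoped Kronecker ENNReal

noncomputable section

namespace ExpDeFinetti

/-- Operators on `(ℂ^d)^{⊗n}`, as matrices in the computational basis
`|i_1, …, i_n⟩`, indexed by the strings `i : Fin n → Fin d`. -/
abbrev Op (d n : ℕ) : Type := Matrix (Fin n → Fin d) (Fin n → Fin d) ℂ

/-- `P_d(π) = ∑_i |i_{π⁻¹(1)}, …, i_{π⁻¹(n)}⟩⟨i_1, …, i_n|`. -/
def permOp (d n : ℕ) (π : Equiv.Perm (Fin n)) : Op d n :=
  Matrix.of fun p i => if p = (fun l => i (π⁻¹ l)) then 1 else 0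

/-- The orthogonal projector onto the symmetric subspace `∨^n ℂ^d`:
`(1/n!) ∑_π P_d(π)`. -/
def symProj (d n : ℕ) : Op d n :=
  ((n.factorial : ℂ)⁻¹) • ∑ π : Equiv.Perm (Fin n), permOp d n π

/-- `d[n] = binom(d+n-1, n)`, the dimension of `∨^n ℂ^d`. -/
def symDim (d n : ℕ) : ℕ := (d + n - 1).choose n

/-- Splitting a string of length `b = a + m` into its first `a` and its last `m` letters:
`(ℂ^d)^{⊗b} = (ℂ^d)^{⊗a} ⊗ (ℂ^d)^{⊗m}`. -/
def splitEquiv (d : ℕ) {a m b : ℕ} (h : a + m = b) :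
    (Fin b → Fin d) ≃ (Fin a → Fin d) × (Fin m → Fin d) :=
  ((finCongr h.symm).arrowCongr (Equiv.refl (Fin d))).trans (Fin.appendEquiv a m).symm

/-- `ρ ↦ ρ ⊗ I^{⊗m}`, from operators on `a` systems to operators on `b = a + m` systems. -/
def padId (d : ℕ) {a m b : ℕ} (h : a + m = b) (ρ : Op d a) : Op d b :=
  (ρ ⊗ₖ (1 : Op d m)).submatrix (splitEquiv d h) (splitEquiv d h)

/-- The partial trace over the last `m` of `b = a + m` systems. -/
def traceLast (d : ℕ) {a m b : ℕ} (h : a + m = b) : Op d b →ₗ[ℂ] Op d a where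
  toFun X := Matrix.of fun i j =>
    ∑ t : Fin m → Fin d, X ((splitEquiv d h).symm (i, t)) ((splitEquiv d h).symm (j, t))
  map_add' X Y := by
    ext i j
    simp [Finset.sum_add_distrib]
  map_smul' c X := by
    ext i j
    simp [Finset.mul_sum]

/-- The partial trace over the first `a` of `b = a + m` systems. -/
def traceFirst (d : ℕ) {a m b : ℕ} (h : a + m = b) : Op d b →ₗ[ℂ] Op d m where
  toFun X := Matrix.of fun i j =>
    ∑ t : Fin a → Fin d, X ((splitEquiv d h).symm (t, i)) ((splitEquiv d h).symm (t, j))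
  map_add' X Y := by
    ext i j
    simp [Finset.sum_add_distrib]
  map_smul' c X := by
    ext i j
    simp [Finset.mul_sum]

lemma padId_add (d : ℕ) {a m b : ℕ} (h : a + m = b) (ρ σ : Op d a) :
    padId d h (ρ + σ) = padId d h ρ + padId d h σ := by
  simp only [padId, Matrix.add_kronecker]
  rfl

lemma padId_smul (d : ℕ) {a m b : ℕ} (h : a + m = b) (c : ℂ) (ρ : Op d a) :
    padId d h (c • ρ) = c • padId d h ρ := by
  simp only [padId, Matrix.smul_kronecker]
  rfl

/-- The tensor power `φ^{⊗n} = (|φ⟩⟨φ|)^{⊗n}` of the rank-one operator of a vector. -/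
def purePow (d n : ℕ) (φ : EuclideanSpace ℂ (Fin d)) : Op d n :=
  Matrix.of fun i j => ∏ l : Fin n, φ (i l) * star (φ (j l))

/-- `E_φ φ^{⊗n}`: the average, entry by entry, over a uniformly random unit vector
`φ ∈ ℂ^d`, that is, over the normalized surface measure of the unit sphere. -/
def avgPurePow (d n : ℕ) : Op d n :=
  Matrix.of fun i j =>
    ⨍ φ : Metric.sphere (0 : EuclideanSpace ℂ (Fin d)) 1, purePow d n φ i j
      ∂(MeasureTheory.volume : MeasureTheory.Measure (EuclideanSpace ℂ (Fin d))).toSphere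

/-- The optimal measure-and-prepare map
`MP_{n→k}(ρ) = tr_n (d[n] E_φ φ^{⊗(n+k)} (ρ ⊗ I^{⊗k}))`, the trace being over the first
`n` systems: measure with the continuous POVM `d[n] φ^{⊗n} dφ` and prepare `φ^{⊗k}`. -/
def MP (d n k : ℕ) : Op d n →ₗ[ℂ] Op d k where
  toFun ρ := traceFirst d (rfl : n + k = n + k)
    ((symDim d n : ℂ) • (avgPurePow d (n + k) * padId d rfl ρ))
  map_add' ρ σ := by
    rw [padId_add, mul_add, smul_add, map_add]
  map_smul' c ρ := by
    rw [padId_smul, Matrix.mul_smul, smul_comm, map_smul, RingHom.id_apply]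

/-- The optimal cloning map `Clone_{a→b}`, with `b = a + m`:
`Clone_{a→b}(ρ) = (d[a] / d[b]) Π_b (ρ ⊗ I^{⊗m}) Π_b`, where `Π_b` is the projector
onto the symmetric subspace. -/
def Clone (d : ℕ) {a m b : ℕ} (h : a + m = b) : Op d a →ₗ[ℂ] Op d b where
  toFun ρ := ((symDim d a : ℂ) / (symDim d b : ℂ)) •
    (symProj d b * padId d h ρ * symProj d b)
  map_add' ρ σ := by
    rw [padId_add, mul_add, add_mul, smul_add]
  map_smul' c ρ := by
    rw [padId_smul, Matrix.mul_smul, Matrix.smul_mul, smul_comm, RingHom.id_apply]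

/-- The trace norm `‖X‖₁ = tr √(X† X)`: the sum of the singular values of `X`. -/
def traceNorm {ι : Type*} [Fintype ι] [DecidableEq ι] (X : Matrix ι ι ℂ) : ℝ :=
  ∑ i, √((Matrix.isHermitian_conjTranspose_mul_self X).eigenvalues i)

/-- `Φ ⊗ id`, where `id` acts on the operators on a reference system `ℂ^m`. -/
def ampliate {ι κ : Type*} (Φ : Matrix ι ι ℂ →ₗ[ℂ] Matrix κ κ ℂ) (m : ℕ)
    (X : Matrix (ι × Fin m) (ι × Fin m) ℂ) : Matrix (κ × Fin m) (κ × Fin m) ℂ :=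
  Matrix.of fun p q => Φ (Matrix.of fun i j => X (i, p.2) (j, q.2)) p.1 q.1

/-- The diamond norm of the restriction of `Φ` to the operators on the subspace `V` onto which
`P` is the orthogonal projector: the supremum of `‖(Φ ⊗ id)(X)‖₁` over all `m` and all
operators `X` on `V ⊗ ℂ^m` with `‖X‖₁ ≤ 1`.  Operators on `V ⊗ ℂ^m` are the matrices
with `(P ⊗ I) X (P ⊗ I) = X`. For `P = 1` this is the usual diamond norm of `Φ`. -/
def diamondNormOn {ι κ : Type*} [Fintype ι] [DecidableEq ι] [Fintype κ] [DecidableEq κ]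
    (P : Matrix ι ι ℂ) (Φ : Matrix ι ι ℂ →ₗ[ℂ] Matrix κ κ ℂ) : ℝ≥0∞ :=
  ⨆ (m : ℕ) (X : Matrix (ι × Fin m) (ι × Fin m) ℂ)
    (_ : (P ⊗ₖ (1 : Matrix (Fin m) (Fin m) ℂ)) * X * (P ⊗ₖ (1 : Matrix (Fin m) (Fin m) ℂ)) = X)
    (_ : traceNorm X ≤ 1), ENNReal.ofReal (traceNorm (ampliate Φ m X))

end ExpDeFinetti

end

/-! On operators on the symmetric subspace the measure-and-prepare map is a positive combination of
clonings of marginals: MP_{n→j} = ∑_{i ≤ j} (A_j B_i / (j-i)!) Clone_{i→j} ∘ tr_{n-i}, where A is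
`coefA`, B is `coefB` and e = d - 1. Apart from the factorial, the coefficient splits into a
function of j and a function of i. Cloning in two stages is cloning in one, so with x_s = (-1)^s /
(s! A_{k-s} B_k) the coefficient of Clone_{k-t→k} ∘ tr_{n-k+t} in the approximating sum is B_{k-t} /
(B_k t!) · ∑_{s ≤ r} (-1)^s C(t,s). This is 1 at t = 0 and 0 for 1 ≤ t ≤ r. For t > r the
alternating sum is (-1)^r C(t-1,r), and B_{k-t}/B_k ≤ δ^t. Hence tr_{n-k} minus the sum is a
combination of the maps Clone ∘ tr with t > r and coefficients at most δ^t in absolute value. Each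
of these maps is a trace-norm contraction even with a reference system, so the diamond norm is at
most the geometric tail δ^(r+1)/(1-δ).

The operator identity (`traceLast_sub_sum_eq`) is checked by polarization. The inputs
|α^{⊗n}⟩⟨β^{⊗n}| span, and an output on the symmetric subspace is determined by its elements between
tensor powers (`mem_span_tpow`, `ext_of_tpow`). There both sides become polynomials in α·β, v·α, β·w
and v·w. The one analytic input is the sphere moment `average_sphere_dotProduct_pow`, obtained from
Gaussian integrals and polarized in `sphereAvg_mixed`.

The norm estimates rest on the trace norm being the least cost ∑ ‖a_i‖‖b_i‖ of a decomposition into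
rank-one matrices. The triangle inequality and the contractivity of maps with Kraus operators follow
from it. Pairings are the bilinear `⬝ᵥ`, without conjugation, so that coefficients of polynomials
can be compared. -/

noncomputable section

/-! ### The trace norm as the least cost of a rank-one decomposition. -/

namespace ExpDeFinetti

open Matrix

/-- The Euclidean norm of a coordinate vector. -/
def l2 {ι : Type*} [Fintype ι] (v : ι → ℂ) : ℝ := ‖WithLp.toLp 2 v‖

lemma l2_nonneg {ι : Type*} [Fintype ι] (v : ι → ℂ) : 0 ≤ l2 v := norm_nonneg _

lemma l2_sq {ι : Type*} [Fintype ι] (v : ι → ℂ) : l2 v ^ 2 = ∑ i, ‖v i‖ ^ 2 := by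
  rw [l2, EuclideanSpace.norm_sq_eq]

lemma l2_smul {ι : Type*} [Fintype ι] (c : ℂ) (v : ι → ℂ) : l2 (c • v) = ‖c‖ * l2 v := by
  rw [l2, WithLp.toLp_smul, norm_smul, l2]

lemma inner_toLp {ι : Type*} [Fintype ι] (v w : ι → ℂ) :
    inner ℂ (WithLp.toLp 2 v) (WithLp.toLp 2 w) = star v ⬝ᵥ w := by
  rw [EuclideanSpace.inner_toLp_toLp, dotProduct_comm]

lemma l2_sq_eq_dotProduct {ι : Type*} [Fintype ι] (v : ι → ℂ) :
    ((l2 v ^ 2 : ℝ) : ℂ) = star v ⬝ᵥ v := by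
  rw [← inner_toLp, inner_self_eq_norm_sq_to_K, l2]; norm_cast

section TraceNorm

variable {ι : Type*} [Fintype ι] [DecidableEq ι]

/-- Any matrix is a sum of rank-one matrices whose norms add up to its trace norm. -/
lemma exists_decomp_traceNorm (X : Matrix ι ι ℂ) :
    ∃ a b : ι → ι → ℂ, X = ∑ i, vecMulVec (a i) (star (b i)) ∧
      ∑ i, l2 (a i) * l2 (b i) = traceNorm X := by
  set hX := isHermitian_conjTranspose_mul_self X
  let v : ι → ι → ℂ := fun i => (hX.eigenvectorBasis i).ofLp
  have hv : ∀ i, l2 (v i) = 1 := fun i => hX.eigenvectorBasis.orthonormal.1 i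
  have hXv : ∀ i, l2 (X *ᵥ v i) = √(hX.eigenvalues i) := by
    intro i
    have h : ((l2 (X *ᵥ v i) ^ 2 : ℝ) : ℂ) = hX.eigenvalues i := by
      rw [l2_sq_eq_dotProduct, star_mulVec, ← dotProduct_mulVec, mulVec_mulVec]
      have := hX.mulVec_eigenvectorBasis i
      rw [show v i = (hX.eigenvectorBasis i).ofLp from rfl, this, dotProduct_smul]
      change hX.eigenvalues i • (star (v i) ⬝ᵥ v i) = _
      rw [← l2_sq_eq_dotProduct, hv]; simp
    rw [← Complex.ofReal_inj.mp h, Real.sqrt_sq (l2_nonneg _)]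
  refine ⟨fun i => X *ᵥ v i, v, ?_, ?_⟩
  -- Completeness of the eigenbasis of `Xᴴ * X` gives X = ∑ (X v_i) v_i†, and ‖X v_i‖ is the i-th
  -- singular value.
  · have hone : ∑ i, vecMulVec (v i) (star (v i)) = 1 := by
      ext p q
      have := hX.eigenvectorUnitary.2.2
      have h2 := congrFun (congrFun this p) q
      rw [← h2, mul_apply, Matrix.sum_apply]
      rfl
    calc X = X * ∑ i, vecMulVec (v i) (star (v i)) := by rw [hone, mul_one]
      _ = _ := by simp only [Finset.mul_sum, mul_vecMulVec]
  · simp only [hv, hXv, mul_one]; rfl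

/-- Bessel's inequality with zero vectors allowed: normalizing the vectors X v_i gives 0 on the
kernel of X. -/
lemma sum_sq_inner_le {κ E : Type*} [Fintype κ] [NormedAddCommGroup E] [InnerProductSpace ℂ E]
    {u : κ → E} (hu : Pairwise fun i j => inner ℂ (u i) (u j) = 0) (hu1 : ∀ i, u i = 0 ∨ ‖u i‖ = 1)
    (x : E) : ∑ i, ‖inner ℂ (u i) x‖ ^ 2 ≤ ‖x‖ ^ 2 := by
  classical
  have ho : Orthonormal ℂ (fun i : {i // u i ≠ 0} => u i) :=
    ⟨fun i => (hu1 i).resolve_left i.2, fun i j hij => hu (fun h => hij (Subtype.ext h))⟩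
  have h := ho.sum_inner_products_le x (s := Finset.univ)
  refine le_trans (le_of_eq ?_) h
  rw [← Finset.sum_subtype (Finset.univ.filter fun i => u i ≠ 0) (by simp)
    (fun i => ‖inner ℂ (u i) x‖ ^ 2), Finset.sum_filter]
  refine Finset.sum_congr rfl fun i _ => ?_
  split_ifs with h0
  · rfl
  · rw [not_not.mp h0, inner_zero_left, norm_zero, zero_pow two_ne_zero]

/-- The trace norm is at most the sum of the norms of the terms of any decomposition into
rank-one matrices. -/
lemma traceNorm_le_of_decomp {κ : Type*} [Fintype κ] (X : Matrix ι ι ℂ) (a b : κ → ι → ℂ)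
    (h : X = ∑ i, vecMulVec (a i) (star (b i))) :
    traceNorm X ≤ ∑ i, l2 (a i) * l2 (b i) := by
  set hX := isHermitian_conjTranspose_mul_self X
  let v : ι → ι → ℂ := fun i => (hX.eigenvectorBasis i).ofLp
  have hvo : ∀ i j, star (v i) ⬝ᵥ v j = if i = j then 1 else 0 := by
    intro i j
    rw [← inner_toLp]
    exact orthonormal_iff_ite.mp hX.eigenvectorBasis.orthonormal i j
  have hXvo : ∀ i j, star (X *ᵥ v i) ⬝ᵥ (X *ᵥ v j) = if i = j then (hX.eigenvalues j : ℂ) else 0 := by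
    intro i j
    rw [star_mulVec, ← dotProduct_mulVec, mulVec_mulVec]
    have := hX.mulVec_eigenvectorBasis j
    rw [show v j = (hX.eigenvectorBasis j).ofLp from rfl, this, dotProduct_smul]
    change hX.eigenvalues j • (star (v i) ⬝ᵥ v j) = _
    rw [hvo]; simp
  have hXv : ∀ i, l2 (X *ᵥ v i) = √(hX.eigenvalues i) := by
    intro i
    have h : ((l2 (X *ᵥ v i) ^ 2 : ℝ) : ℂ) = hX.eigenvalues i := by
      rw [l2_sq_eq_dotProduct, hXvo, if_pos rfl]
    rw [← Complex.ofReal_inj.mp h, Real.sqrt_sq (l2_nonneg _)]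
  -- The left singular vectors. Since the inverse of 0 is 0, those belonging to the singular value 0
  -- vanish.
  let w : ι → EuclideanSpace ℂ ι := fun i =>
    (((l2 (X *ᵥ v i))⁻¹ : ℝ) : ℂ) • WithLp.toLp 2 (X *ᵥ v i)
  have hwo : Pairwise fun i j => inner ℂ (w i) (w j) = 0 := by
    intro i j hij
    simp only [w, inner_smul_left, inner_smul_right, inner_toLp]
    rw [hXvo, if_neg hij]; simp
  have hw1 : ∀ i, w i = 0 ∨ ‖w i‖ = 1 := by
    intro i
    by_cases h0 : l2 (X *ᵥ v i) = 0
    · left; simp [w, h0]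
    · right
      simp only [w, norm_smul, Complex.norm_real, norm_inv, Real.norm_of_nonneg (l2_nonneg _)]
      exact inv_mul_cancel₀ h0
  have hwX : ∀ l, inner ℂ (w l) (WithLp.toLp 2 (X *ᵥ v l)) = (√(hX.eigenvalues l) : ℂ) := by
    intro l
    rw [← hXv]
    simp only [w, inner_smul_left, inner_toLp]
    rw [← l2_sq_eq_dotProduct, Complex.conj_ofReal, ← Complex.ofReal_mul, Complex.ofReal_inj]
    by_cases h0 : l2 (X *ᵥ v l) = 0
    · simp [h0]
    · field_simp
  have hexp : ∀ l, (√(hX.eigenvalues l) : ℂ) =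
      ∑ i, inner ℂ (w l) (WithLp.toLp 2 (a i)) * inner ℂ (WithLp.toLp 2 (b i)) (WithLp.toLp 2 (v l)) := by
    intro l
    rw [← hwX l]
    have : X *ᵥ v l = ∑ i, (star (b i) ⬝ᵥ v l) • a i := by
      conv_lhs => rw [h]
      rw [sum_mulVec]
      refine Finset.sum_congr rfl fun i _ => ?_
      rw [vecMulVec_mulVec, op_smul_eq_smul]
    rw [this, WithLp.toLp_sum, inner_sum]
    refine Finset.sum_congr rfl fun i _ => ?_
    rw [WithLp.toLp_smul, inner_smul_right, inner_toLp (b i), mul_comm]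
  -- The trace norm is ∑_l ⟨w_l, X v_l⟩. With the given decomposition inserted for X, each term i is
  -- bounded by Cauchy-Schwarz in l and by Bessel for both families.
  have hkey : (traceNorm X : ℂ) = ∑ i, ∑ l,
      inner ℂ (w l) (WithLp.toLp 2 (a i)) * inner ℂ (WithLp.toLp 2 (b i)) (WithLp.toLp 2 (v l)) := by
    rw [Finset.sum_comm, traceNorm, Complex.ofReal_sum]
    exact Finset.sum_congr rfl fun l _ => hexp l
  have hnn : 0 ≤ traceNorm X := Finset.sum_nonneg fun i _ => Real.sqrt_nonneg _
  calc traceNorm X = ‖(traceNorm X : ℂ)‖ := by rw [Complex.norm_real, Real.norm_of_nonneg hnn]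
    _ ≤ ∑ i, ∑ l, ‖inner ℂ (w l) (WithLp.toLp 2 (a i))‖ *
          ‖inner ℂ (WithLp.toLp 2 (b i)) (WithLp.toLp 2 (v l))‖ := by
        rw [hkey]
        refine (norm_sum_le _ _).trans (Finset.sum_le_sum fun i _ => ?_)
        refine (norm_sum_le _ _).trans (Finset.sum_le_sum fun l _ => ?_)
        rw [norm_mul]
    _ ≤ _ := by
        refine Finset.sum_le_sum fun i _ => ?_
        refine (Real.sum_mul_le_sqrt_mul_sqrt _ _ _).trans ?_
        refine mul_le_mul ?_ ?_ (Real.sqrt_nonneg _) (l2_nonneg _)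
        · exact Real.sqrt_le_iff.mpr ⟨l2_nonneg _, sum_sq_inner_le hwo hw1 _⟩
        · refine Real.sqrt_le_iff.mpr ⟨l2_nonneg _, ?_⟩
          simp_rw [norm_inner_symm (WithLp.toLp 2 (b i))]
          exact hX.eigenvectorBasis.orthonormal.sum_inner_products_le _

/-- The triangle inequality for a finite linear combination. -/
lemma traceNorm_sum_smul_le {κ : Type*} [Fintype κ] (c : κ → ℂ) (Y : κ → Matrix ι ι ℂ) :
    traceNorm (∑ t, c t • Y t) ≤ ∑ t, ‖c t‖ * traceNorm (Y t) := by
  choose a b hab hn using fun t => exists_decomp_traceNorm (Y t)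
  refine (traceNorm_le_of_decomp _ (fun p : κ × ι => c p.1 • a p.1 p.2)
    (fun p => b p.1 p.2) ?_).trans (le_of_eq ?_)
  · rw [Fintype.sum_prod_type]
    refine Finset.sum_congr rfl fun t _ => ?_
    conv_lhs => rw [hab t]
    simp only [Finset.smul_sum, smul_vecMulVec]
  · rw [Fintype.sum_prod_type]
    refine Finset.sum_congr rfl fun t _ => ?_
    simp only [l2_smul, mul_assoc, ← Finset.mul_sum, hn]

end TraceNorm

/-! ### Trace-norm contractivity from Kraus operators. -/

section Kraus

variable {ι κ : Type*} [Fintype ι] [DecidableEq ι] [Fintype κ] [DecidableEq κ]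

/-- A map with Kraus operators `K_l` such that `∑ K_l† K_l ≤ 1` does not increase the trace
norm, even in the presence of a reference system. -/
lemma traceNorm_ampliate_le_of_kraus {L : Type*} [Fintype L]
    (Φ : Matrix ι ι ℂ →ₗ[ℂ] Matrix κ κ ℂ) (K : L → Matrix κ ι ℂ)
    (hΦ : ∀ X, Φ X = ∑ l, K l * X * (K l)ᴴ)
    (hK : ∀ v : ι → ℂ, ∑ l, l2 (K l *ᵥ v) ^ 2 ≤ l2 v ^ 2) (m : ℕ)
    (X : Matrix (ι × Fin m) (ι × Fin m) ℂ) : traceNorm (ampliate Φ m X) ≤ traceNorm X := by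
  obtain ⟨a, b, hX, hn⟩ := exists_decomp_traceNorm X
  -- This is K_l ⊗ 1. Applied to an optimal decomposition of X it yields a decomposition of the
  -- image, and by Cauchy-Schwarz in l each pair (a, b) costs at most ‖a‖‖b‖.
  let A : L → (ι × Fin m → ℂ) → (κ × Fin m → ℂ) := fun l v p => (K l *ᵥ fun i => v (i, p.2)) p.1
  have hA : ∀ v, ∑ l, l2 (A l v) ^ 2 ≤ l2 v ^ 2 := by
    intro v
    have h : ∀ l, l2 (A l v) ^ 2 = ∑ y, l2 (K l *ᵥ fun i => v (i, y)) ^ 2 := by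
      intro l
      simp only [l2_sq, Fintype.sum_prod_type_right, A]
    simp only [h]
    rw [Finset.sum_comm, l2_sq, Fintype.sum_prod_type_right]
    refine Finset.sum_le_sum fun y _ => ?_
    rw [← l2_sq (fun i => v (i, y))]
    exact hK _
  refine (traceNorm_le_of_decomp _ (fun p : (ι × Fin m) × L => A p.2 (a p.1))
    (fun p => A p.2 (b p.1)) ?_).trans ?_
  · ext p q
    have hb : (of fun i j => X (i, p.2) (j, q.2)) = ∑ s, vecMulVec (fun i => a s (i, p.2))
        (star fun i => b s (i, q.2)) := by
      ext i j
      rw [of_apply, hX, Matrix.sum_apply, Matrix.sum_apply]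
      rfl
    rw [ampliate, of_apply, hb, hΦ, Matrix.sum_apply, Matrix.sum_apply]
    refine Eq.trans (Finset.sum_congr rfl fun l _ => ?_) (Fintype.sum_prod_type_right _).symm
    rw [Matrix.mul_sum, Matrix.sum_mul, Matrix.sum_apply]
    refine Finset.sum_congr rfl fun s _ => ?_
    rw [mul_vecMulVec, vecMulVec_mul, ← star_mulVec]
    rfl
  · rw [← hn]
    refine (Fintype.sum_prod_type _).trans_le (Finset.sum_le_sum fun s _ => ?_)
    refine (Real.sum_mul_le_sqrt_mul_sqrt _ _ _).trans ?_
    have h1 : √(∑ l, l2 (A l (a s)) ^ 2) ≤ l2 (a s) :=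
      Real.sqrt_le_iff.mpr ⟨l2_nonneg _, hA (a s)⟩
    have h2 : √(∑ l, l2 (A l (b s)) ^ 2) ≤ l2 (b s) :=
      Real.sqrt_le_iff.mpr ⟨l2_nonneg _, hA (b s)⟩
    exact mul_le_mul h1 h2 (Real.sqrt_nonneg _) (l2_nonneg _)

end Kraus

end ExpDeFinetti

end

/-! ### Polarization on the symmetric subspace. -/

noncomputable section

namespace ExpDeFinetti

open Matrix

/-- Ryser's formula for the permanent. -/
lemma sum_neg_one_pow_mul_prod_sum {n : ℕ} (M : Fin n → Fin n → ℂ) :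
    ∑ S : Finset (Fin n), (-1) ^ Sᶜ.card * ∏ l, ∑ i ∈ S, M i l =
      ∑ π : Equiv.Perm (Fin n), ∏ l, M (π l) l := by
  have h1 : ∀ S : Finset (Fin n), (-1) ^ Sᶜ.card * ∏ l, ∑ i ∈ S, M i l =
      ∑ f : Fin n → Fin n, (if ∀ l, f l ∈ S then (-1) ^ Sᶜ.card else 0) * ∏ l, M (f l) l := by
    intro S
    rw [Finset.prod_univ_sum, Finset.mul_sum]
    simp only [ite_mul, zero_mul]
    rw [← Finset.sum_filter]
    refine Finset.sum_congr ?_ fun _ _ => rfl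
    ext f
    simp [Fintype.mem_piFinset]
  have h2 : ∀ f : Fin n → Fin n,
      ∑ S : Finset (Fin n), (if ∀ l, f l ∈ S then (-1 : ℂ) ^ Sᶜ.card else 0) =
        if Function.Surjective f then 1 else 0 := by
    intro f
    -- In terms of complements the sum runs over all subsets of the complement of the range of f, so
    -- its signs cancel unless that complement is empty.
    rw [← Equiv.sum_comp (⟨compl, compl, compl_compl, compl_compl⟩ : Finset (Fin n) ≃ Finset (Fin n))]
    have h3 := Finset.sum_powerset_neg_one_pow_card (x := (Finset.univ.image f)ᶜ)
    have h4 : ∑ S : Finset (Fin n), (if ∀ l, f l ∈ Sᶜ then (-1 : ℂ) ^ Sᶜᶜ.card else 0) =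
        ((∑ m ∈ ((Finset.univ.image f)ᶜ).powerset, (-1) ^ m.card : ℤ) : ℂ) := by
      rw [← Finset.sum_filter]
      push_cast
      refine Finset.sum_congr ?_ fun S _ => by rw [compl_compl]
      ext S
      simp only [Finset.mem_filter, Finset.mem_univ, true_and, Finset.mem_compl,
        Finset.mem_powerset, Finset.subset_iff, Finset.mem_image, not_exists]
      exact ⟨fun h x hx l hl => h l (hl ▸ hx), fun h l hl => h hl l rfl⟩
    refine h4.trans ?_
    rw [h3]
    have : (Finset.univ.image f)ᶜ = ∅ ↔ Function.Surjective f := by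
      rw [Finset.compl_eq_empty_iff, Finset.eq_univ_iff_forall]
      simp [Function.Surjective]
    simp only [this]
    split_ifs <;> simp
  simp only [h1]
  rw [Finset.sum_comm]
  simp only [← Finset.sum_mul, h2]
  symm
  refine Finset.sum_of_injOn (fun π : Equiv.Perm (Fin n) => (π : Fin n → Fin n))
    (fun _ _ _ _ h => DFunLike.coe_injective h) (fun _ _ => Finset.mem_coe.mpr (Finset.mem_univ _))
    ?_ fun π _ => ?_
  · intro f _ hf
    rw [if_neg, zero_mul]
    intro hs
    exact hf ⟨Equiv.ofBijective f (Finite.surjective_iff_bijective.mp hs), by simp, rfl⟩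
  · rw [if_pos π.surjective, one_mul]

/-- The coordinates of the tensor power `α^{⊗n}` of a vector. -/
def tpow (n : ℕ) {d : ℕ} (α : Fin d → ℂ) : (Fin n → Fin d) → ℂ := fun i => ∏ l, α (i l)

lemma tpow_dotProduct_tpow (n : ℕ) {d : ℕ} (α β : Fin d → ℂ) :
    tpow n α ⬝ᵥ tpow n β = (α ⬝ᵥ β) ^ n := by
  simp only [dotProduct, tpow, ← Finset.prod_mul_distrib]
  exact (Fintype.sum_pow (fun a => α a * β a) n).symm

lemma permOp_mulVec {d n : ℕ} (π : Equiv.Perm (Fin n)) (v : (Fin n → Fin d) → ℂ) (p : Fin n → Fin d) :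
    (permOp d n π *ᵥ v) p = v (p ∘ π) := by
  have h : ∀ i : Fin n → Fin d, (p = fun l => i (π⁻¹ l)) ↔ i = p ∘ π := by
    intro i
    constructor
    · rintro rfl; ext l; simp
    · rintro rfl; ext l; simp
  simp only [mulVec, dotProduct, permOp, of_apply, h, ite_mul, one_mul, zero_mul,
    Finset.sum_ite_eq', Finset.mem_univ, if_true]

lemma symProj_mulVec {d n : ℕ} (v : (Fin n → Fin d) → ℂ) (p : Fin n → Fin d) :
    (symProj d n *ᵥ v) p = (n.factorial : ℂ)⁻¹ * ∑ π : Equiv.Perm (Fin n), v (p ∘ π) := by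
  rw [symProj, smul_mulVec, sum_mulVec, Pi.smul_apply, Finset.sum_apply, smul_eq_mul]
  simp only [permOp_mulVec]

lemma factorial_inv_mul_sum_const (n : ℕ) (c : ℂ) :
    (n.factorial : ℂ)⁻¹ * ∑ _π : Equiv.Perm (Fin n), c = c := by
  have : (n.factorial : ℂ) ≠ 0 := by exact_mod_cast n.factorial_ne_zero
  rw [Finset.sum_const, Finset.card_univ, Fintype.card_perm, Fintype.card_fin, nsmul_eq_mul,
    inv_mul_cancel_left₀ this]

lemma symProj_mulVec_of_forall {d n : ℕ} (v : (Fin n → Fin d) → ℂ)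
    (h : ∀ (π : Equiv.Perm (Fin n)) p, v (p ∘ π) = v p) : symProj d n *ᵥ v = v := by
  ext p
  rw [symProj_mulVec]
  simp only [h, factorial_inv_mul_sum_const]

lemma symProj_mulVec_tpow {d n : ℕ} (α : Fin d → ℂ) : symProj d n *ᵥ tpow n α = tpow n α :=
  symProj_mulVec_of_forall _ fun π p => Equiv.prod_comp π fun l => α (p l)

lemma symProj_mul_symProj (d n : ℕ) : symProj d n * symProj d n = symProj d n := by
  refine ext_of_mulVec_single fun i => ?_
  rw [← mulVec_mulVec]
  refine symProj_mulVec_of_forall _ fun π p => ?_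
  rw [symProj_mulVec, symProj_mulVec]
  congr 1
  exact Equiv.sum_comp (Equiv.mulLeft π)
    (fun σ : Equiv.Perm (Fin n) => (Pi.single i (1 : ℂ) : (Fin n → Fin d) → ℂ) (p ∘ σ))

lemma permOp_transpose {d n : ℕ} (π : Equiv.Perm (Fin n)) :
    (permOp d n π)ᵀ = permOp d n π⁻¹ := by
  ext p i
  simp only [transpose_apply, permOp, of_apply]
  congr 1
  rw [eq_iff_iff]
  constructor
  · rintro rfl; ext l; simp
  · rintro rfl; ext l; simp

lemma symProj_transpose (d n : ℕ) : (symProj d n)ᵀ = symProj d n := by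
  rw [symProj, transpose_smul, transpose_sum]
  simp only [permOp_transpose]
  exact congrArg _ (Equiv.sum_comp (Equiv.inv (Equiv.Perm (Fin n))) (fun π => permOp d n π))

lemma symProj_conjTranspose (d n : ℕ) : (symProj d n)ᴴ = symProj d n := by
  conv_rhs => rw [← symProj_transpose]
  rw [conjTranspose]
  ext p i
  simp [symProj, permOp, Matrix.sum_apply]

lemma tpow_vecMul_symProj {d n : ℕ} (α : Fin d → ℂ) : tpow n α ᵥ* symProj d n = tpow n α := by
  rw [← mulVec_transpose, symProj_transpose, symProj_mulVec_tpow]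

/-- The columns of the projector onto the symmetric subspace are combinations of tensor
powers. -/
lemma exists_symProj_eq_sum_tpow (d n : ℕ) (x : Fin n → Fin d) :
    ∃ (c : Finset (Fin n) → ℂ) (α : Finset (Fin n) → Fin d → ℂ),
      ∀ p, symProj d n p x = ∑ S, c S * tpow n (α S) p := by
  -- The vectors are the subset sums of the basis vectors e_{x_i}. Ryser's formula turns the signed
  -- sum of their tensor powers into the symmetrization of e_{x_1} ⊗ ⋯ ⊗ e_{x_n}.
  refine ⟨fun S => (n.factorial : ℂ)⁻¹ * (-1) ^ Sᶜ.card,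
    fun S a => ∑ i ∈ S, if x i = a then 1 else 0, fun p => ?_⟩
  have h := sum_neg_one_pow_mul_prod_sum (fun i l => if x i = p l then (1 : ℂ) else 0)
  simp only [tpow, mul_assoc, ← Finset.mul_sum, h]
  rw [symProj, Matrix.smul_apply, Matrix.sum_apply, smul_eq_mul,
    ← Equiv.sum_comp (Equiv.inv (Equiv.Perm (Fin n)))]
  congr 1
  refine Finset.sum_congr rfl fun π _ => ?_
  simp only [permOp, of_apply, Equiv.inv_apply, inv_inv]
  rw [Finset.prod_ite_zero]
  simp only [Finset.prod_const_one, Finset.mem_univ, true_imp_iff]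
  congr 1
  rw [eq_iff_iff]
  constructor
  · rintro rfl l; rfl
  · intro h; ext l; rw [h]

/-- Operators on the symmetric subspace are determined by their matrix elements between tensor
powers. -/
lemma ext_of_tpow {d n : ℕ} {X Y : Op d n} (hX : symProj d n * X * symProj d n = X)
    (hY : symProj d n * Y * symProj d n = Y)
    (h : ∀ v w, tpow n v ⬝ᵥ X *ᵥ tpow n w = tpow n v ⬝ᵥ Y *ᵥ tpow n w) : X = Y := by
  have key : ∀ Z : Op d n, symProj d n * Z * symProj d n = Z → ∀ (x y : Fin n → Fin d)
      (c : Finset (Fin n) → ℂ) (α : Finset (Fin n) → Fin d → ℂ) (c' : Finset (Fin n) → ℂ)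
      (α' : Finset (Fin n) → Fin d → ℂ),
      (∀ p, symProj d n p x = ∑ S, c S * tpow n (α S) p) →
      (∀ p, symProj d n p y = ∑ S, c' S * tpow n (α' S) p) →
      Z x y = ∑ S : Finset (Fin n), ∑ S' : Finset (Fin n),
        c S * c' S' * (tpow n (α S) ⬝ᵥ Z *ᵥ tpow n (α' S')) := by
    intro Z hZ x y c α c' α' h1 h2
    have e1 : (symProj d n).row x = ∑ S, c S • tpow n (α S) := by
      ext p
      rw [← symProj_transpose]
      simp [row, h1]
    have e2 : (symProj d n).col y = ∑ S, c' S • tpow n (α' S) := by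
      ext p
      simp [col, h2]
    have : Z x y = (symProj d n).row x ⬝ᵥ Z *ᵥ (symProj d n).col y := by
      conv_lhs => rw [← hZ, mul_assoc]
      rfl
    rw [this, e1, e2, sum_dotProduct]
    refine Finset.sum_congr rfl fun S _ => ?_
    rw [mulVec_sum, dotProduct_sum]
    refine Finset.sum_congr rfl fun S' _ => ?_
    rw [mulVec_smul, smul_dotProduct, dotProduct_smul, smul_eq_mul, smul_eq_mul, mul_assoc]
  ext x y
  obtain ⟨c, α, h1⟩ := exists_symProj_eq_sum_tpow d n x
  obtain ⟨c', α', h2⟩ := exists_symProj_eq_sum_tpow d n y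
  rw [key X hX x y c α c' α' h1 h2, key Y hY x y c α c' α' h1 h2]
  simp only [h]

/-- Operators on the symmetric subspace are combinations of the operators
`|α^{⊗n}⟩⟨β^{⊗n}|`. -/
lemma mem_span_tpow {d n : ℕ} {X : Op d n} (hX : symProj d n * X * symProj d n = X) :
    X ∈ Submodule.span ℂ (Set.range fun p : (Fin d → ℂ) × (Fin d → ℂ) =>
      vecMulVec (tpow n p.1) (tpow n p.2)) := by
  choose c α h using exists_symProj_eq_sum_tpow d n
  have : X = ∑ x, ∑ y, ∑ S, ∑ S',
      (X x y * c x S * c y S') • vecMulVec (tpow n (α x S)) (tpow n (α y S')) := by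
    conv_lhs => rw [← hX]
    ext p q
    have hq : ∀ y, symProj d n y q = symProj d n q y := fun y => by
      conv_lhs => rw [← symProj_transpose]
      rfl
    have he : (symProj d n * X * symProj d n) p q =
        ∑ x, ∑ y, symProj d n p x * X x y * symProj d n q y := by
      simp only [mul_apply, Finset.sum_mul, hq]
      exact Finset.sum_comm
    rw [he, Matrix.sum_apply]
    refine Finset.sum_congr rfl fun x _ => ?_
    rw [Matrix.sum_apply]
    refine Finset.sum_congr rfl fun y _ => ?_
    rw [h x p, h y q, mul_comm _ (X x y), mul_assoc, Finset.sum_mul_sum, Finset.mul_sum,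
      Matrix.sum_apply]
    refine Finset.sum_congr rfl fun S _ => ?_
    rw [Finset.mul_sum, Matrix.sum_apply]
    refine Finset.sum_congr rfl fun S' _ => ?_
    rw [Matrix.smul_apply, vecMulVec_apply, smul_eq_mul]
    ring
  rw [this]
  exact Submodule.sum_mem _ fun x _ => Submodule.sum_mem _ fun y _ => Submodule.sum_mem _ fun S _ =>
    Submodule.sum_mem _ fun S' _ => Submodule.smul_mem _ _ (Submodule.subset_span ⟨(_, _), rfl⟩)

end ExpDeFinetti

end

noncomputable section

namespace ExpDeFinetti

open Matrix MeasureTheory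

/-! ### Gaussian moments. -/

section Gaussian

lemma norm_pow_mul_conj_pow_mul_exp (a b : ℕ) (z : ℂ) :
    ‖z ^ a * (starRingEnd ℂ z) ^ b * (Real.exp (-‖z‖ ^ 2) : ℂ)‖ =
      ‖z‖ ^ ((a + b : ℕ) : ℝ) * Real.exp (-‖z‖ ^ (2 : ℝ)) := by
  rw [norm_mul, norm_mul, norm_pow, norm_pow, RCLike.norm_conj, Complex.norm_real,
    Real.norm_of_nonneg (Real.exp_pos _).le, Real.rpow_natCast, pow_add, Real.rpow_two]

lemma integral_norm_pow_mul_exp (m : ℕ) :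
    ∫ z : ℂ, ‖z‖ ^ (m : ℝ) * Real.exp (-‖z‖ ^ (2 : ℝ)) = Real.pi * Real.Gamma ((m + 2) / 2) := by
  rw [Complex.integral_rpow_mul_exp_neg_rpow one_le_two
    (by have : (0 : ℝ) ≤ m := m.cast_nonneg
        linarith)]
  ring

lemma integrable_pow_mul_conj_pow_mul_exp (a b : ℕ) :
    Integrable fun z : ℂ => z ^ a * (starRingEnd ℂ z) ^ b * (Real.exp (-‖z‖ ^ 2) : ℂ) := by
  have h : Integrable fun z : ℂ => ‖z‖ ^ ((a + b : ℕ) : ℝ) * Real.exp (-‖z‖ ^ (2 : ℝ)) := by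
    -- A non-integrable function has integral 0 by convention, so a nonzero value proves
    -- integrability.
    apply Integrable.of_integral_ne_zero
    rw [integral_norm_pow_mul_exp]
    exact (mul_pos Real.pi_pos (Real.Gamma_pos_of_pos (by positivity))).ne'
  refine Integrable.mono' h (Continuous.aestronglyMeasurable (by fun_prop)) ?_
  exact Filter.Eventually.of_forall fun z => (norm_pow_mul_conj_pow_mul_exp a b z).le

/-- The moments of the standard Gaussian weight on the complex plane. -/
lemma integral_pow_mul_conj_pow_mul_exp (a b : ℕ) :
    ∫ z : ℂ, z ^ a * (starRingEnd ℂ z) ^ b * (Real.exp (-‖z‖ ^ 2) : ℂ) =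
      if a = b then (Real.pi * a.factorial : ℂ) else 0 := by
  split_ifs with hab
  · subst hab
    have h : ∀ z : ℂ, z ^ a * (starRingEnd ℂ z) ^ a * (Real.exp (-‖z‖ ^ 2) : ℂ) =
        ((‖z‖ ^ ((a + a : ℕ) : ℝ) * Real.exp (-‖z‖ ^ (2 : ℝ)) : ℝ) : ℂ) := by
      intro z
      rw [← mul_pow, Complex.mul_conj, Complex.normSq_eq_norm_sq, Real.rpow_natCast, Real.rpow_two]
      push_cast
      rw [← pow_mul, two_mul]
    simp only [h]
    rw [integral_complex_ofReal, integral_norm_pow_mul_exp]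
    have : (((a + a : ℕ) : ℝ) + 2) / 2 = a + 1 := by push_cast; ring
    rw [this, Real.Gamma_nat_eq_factorial]
    push_cast
    ring
  -- Rotation by this angle preserves the measure and multiplies the integrand by exp(i(a-b)θ) = -1.
  · set θ : ℝ := Real.pi / ((a : ℝ) - b)
    have hne : (a : ℝ) - b ≠ 0 := sub_ne_zero.mpr (Nat.cast_injective.ne hab)
    have hθ : (a : ℝ) * θ - b * θ = Real.pi := by
      rw [← sub_mul]; exact mul_div_cancel₀ _ hne
    set u : Circle := Circle.exp θ
    have hu : (u : ℂ) ^ a * (starRingEnd ℂ (u : ℂ)) ^ b = -1 := by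
      rw [Circle.coe_exp, ← Complex.exp_conj, ← Complex.exp_nat_mul, ← Complex.exp_nat_mul,
        ← Complex.exp_add, ← Complex.exp_pi_mul_I]
      congr 1
      rw [← hθ]
      simp only [map_mul, Complex.conj_ofReal, Complex.conj_I]
      push_cast
      ring
    have h := (rotation u).measurePreserving.integral_comp
      (rotation u).toHomeomorph.measurableEmbedding
      (fun z : ℂ => z ^ a * (starRingEnd ℂ z) ^ b * (Real.exp (-‖z‖ ^ 2) : ℂ))
    have h2 : ∀ z : ℂ, (rotation u z) ^ a * (starRingEnd ℂ (rotation u z)) ^ b *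
        (Real.exp (-‖rotation u z‖ ^ 2) : ℂ) =
        -(z ^ a * (starRingEnd ℂ z) ^ b * (Real.exp (-‖z‖ ^ 2) : ℂ)) := by
      intro z
      rw [LinearIsometryEquiv.norm_map, rotation_apply, map_mul, mul_pow, mul_pow,
        mul_mul_mul_comm, hu]
      ring
    simp only [h2, integral_neg] at h
    exact self_eq_neg.mp h.symm

/-- The Gaussian integral of a product of powers of linear forms. -/
lemma integral_dotProduct_pow_mul_exp {d : ℕ} (N : ℕ) (β α : Fin d → ℂ) :
    ∫ φ : Fin d → ℂ, (β ⬝ᵥ φ) ^ N * (star φ ⬝ᵥ α) ^ N * (Real.exp (-∑ i, ‖φ i‖ ^ 2) : ℂ) =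
      (N.factorial * Real.pi ^ d : ℂ) * (β ⬝ᵥ α) ^ N := by
  set A := Finset.univ.piAntidiag (ι := Fin d) N
  have hexp : ∀ φ : Fin d → ℂ,
      (β ⬝ᵥ φ) ^ N * (star φ ⬝ᵥ α) ^ N * (Real.exp (-∑ i, ‖φ i‖ ^ 2) : ℂ) =
      ∑ m ∈ A, ∑ m' ∈ A, (Nat.multinomial Finset.univ m * (∏ i, β i ^ m i) *
        (Nat.multinomial Finset.univ m' * ∏ i, α i ^ m' i)) *
        ∏ i, (φ i ^ m i * (starRingEnd ℂ (φ i)) ^ m' i * (Real.exp (-‖φ i‖ ^ 2) : ℂ)) := by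
    intro φ
    rw [dotProduct, dotProduct, Finset.sum_pow_eq_sum_piAntidiag, Finset.sum_pow_eq_sum_piAntidiag,
      Finset.sum_mul_sum, Finset.sum_mul]
    refine Finset.sum_congr rfl fun m _ => ?_
    rw [Finset.sum_mul]
    refine Finset.sum_congr rfl fun m' _ => ?_
    simp only [Finset.prod_mul_distrib, mul_pow, ← Finset.sum_neg_distrib, Real.exp_sum]
    push_cast
    simp only [Pi.star_apply, RCLike.star_def]
    ring
  have hint : ∀ m m' : Fin d → ℕ, Integrable fun φ : Fin d → ℂ =>
      ∏ i, (φ i ^ m i * (starRingEnd ℂ (φ i)) ^ m' i * (Real.exp (-‖φ i‖ ^ 2) : ℂ)) :=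
    fun m m' => Integrable.fintype_prod
      (f := fun i (z : ℂ) => z ^ m i * (starRingEnd ℂ z) ^ m' i * (Real.exp (-‖z‖ ^ 2) : ℂ))
      fun i => integrable_pow_mul_conj_pow_mul_exp _ _
  have hval : ∀ m m' : Fin d → ℕ, ∫ φ : Fin d → ℂ,
      ∏ i, (φ i ^ m i * (starRingEnd ℂ (φ i)) ^ m' i * (Real.exp (-‖φ i‖ ^ 2) : ℂ)) =
      if m = m' then (Real.pi ^ d * ∏ i, ((m i).factorial : ℂ) : ℂ) else 0 := by
    intro m m'
    rw [integral_fintype_prod_volume_eq_prod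
      (f := fun i (z : ℂ) => z ^ m i * (starRingEnd ℂ z) ^ m' i * (Real.exp (-‖z‖ ^ 2) : ℂ))]
    simp only [integral_pow_mul_conj_pow_mul_exp]
    rw [Finset.prod_ite_zero, Finset.prod_mul_distrib, Finset.prod_const, Finset.card_univ,
      Fintype.card_fin]
    simp only [Finset.mem_univ, true_imp_iff, funext_iff]
  simp only [hexp]
  rw [integral_finsetSum _ fun m _ => integrable_finsetSum _ fun m' _ => (hint m m').const_mul _,
    dotProduct, Finset.sum_pow_eq_sum_piAntidiag, Finset.mul_sum]
  refine Finset.sum_congr rfl fun m hm => ?_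
  rw [integral_finsetSum _ fun m' _ => (hint m m').const_mul _]
  simp only [integral_const_mul, hval, mul_ite, mul_zero]
  rw [Finset.sum_ite_eq, if_pos hm]
  have hs := Nat.multinomial_spec Finset.univ m
  rw [(Finset.mem_piAntidiag.mp hm).1] at hs
  have hs' : (∏ i, ((m i).factorial : ℂ)) * Nat.multinomial Finset.univ m = N.factorial := by
    exact_mod_cast hs
  rw [← hs']
  simp only [mul_pow, Finset.prod_mul_distrib]
  ring

end Gaussian

/-! ### From Gaussian integrals to sphere averages. -/

section Sphere

variable {d : ℕ}

/-- Polar coordinates for a homogeneous function against the Gaussian weight. -/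
lemma integral_homogeneous_mul_exp (hd : 0 < d) (N : ℕ) (f : EuclideanSpace ℂ (Fin d) → ℂ)
    (hf : ∀ (r : ℝ) x, f (r • x) = (r : ℂ) ^ (2 * N) * f x) :
    ∫ x, f x * (Real.exp (-‖x‖ ^ 2) : ℂ) =
      (∫ x : Metric.sphere (0 : EuclideanSpace ℂ (Fin d)) 1, f x
        ∂(volume : Measure (EuclideanSpace ℂ (Fin d))).toSphere) * (Real.Gamma (N + d) / 2 : ℝ) := by
  have hdim : Module.finrank ℝ (EuclideanSpace ℂ (Fin d)) = 2 * d := by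
    rw [finrank_real_of_complex, finrank_euclideanSpace_fin]
  set μ : Measure (EuclideanSpace ℂ (Fin d)) := volume
  calc ∫ x, f x * (Real.exp (-‖x‖ ^ 2) : ℂ) ∂μ
      = ∫ x : ({(0)}ᶜ : Set (EuclideanSpace ℂ (Fin d))),
          f x * (Real.exp (-‖x.1‖ ^ 2) : ℂ) ∂(μ.comap (↑)) := by
        rw [integral_subtype_comap (measurableSet_singleton _).compl
          fun x ↦ f x * (Real.exp (-‖x‖ ^ 2) : ℂ)]
        have : Nonempty (Fin d) := ⟨⟨0, hd⟩⟩
        rw [restrict_compl_singleton]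
    _ = ∫ p, f p.1 * ((p.2 : ℝ) ^ (2 * N) * Real.exp (-(p.2 : ℝ) ^ 2) : ℂ)
          ∂μ.toSphere.prod (.volumeIoiPow (Module.finrank ℝ (EuclideanSpace ℂ (Fin d)) - 1)) := by
        rw [← μ.measurePreserving_homeomorphUnitSphereProd.integral_comp
          (Homeomorph.measurableEmbedding _)]
        refine integral_congr_ae (Filter.Eventually.of_forall fun x => ?_)
        have hx : ‖x.1‖ ≠ 0 := norm_ne_zero_iff.mpr x.2
        have h := hf ‖x.1‖ (‖x.1‖⁻¹ • x.1)
        rw [smul_inv_smul₀ hx] at h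
        simp only [homeomorphUnitSphereProd_apply_snd_coe, homeomorphUnitSphereProd_apply_fst_coe]
        rw [h]
        push_cast
        ring
    _ = (∫ x : Metric.sphere (0 : EuclideanSpace ℂ (Fin d)) 1, f x ∂μ.toSphere) *
          ∫ r : Set.Ioi (0 : ℝ), ((r : ℝ) ^ (2 * N) * Real.exp (-(r : ℝ) ^ 2) : ℂ)
          ∂(.volumeIoiPow (2 * d - 1)) := by
        rw [hdim]
        exact integral_prod_mul (fun x : Metric.sphere (0 : EuclideanSpace ℂ (Fin d)) 1 => f x)
          fun r : Set.Ioi (0 : ℝ) => ((r : ℝ) ^ (2 * N) * Real.exp (-(r : ℝ) ^ 2) : ℂ)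
    _ = _ := by
        congr 1
        have h1 : ∀ r : Set.Ioi (0 : ℝ), ((r : ℝ) ^ (2 * N) * Real.exp (-(r : ℝ) ^ 2) : ℂ) =
            (((r : ℝ) ^ (2 * N) * Real.exp (-(r : ℝ) ^ 2) : ℝ) : ℂ) := by intro r; push_cast; rfl
        simp only [h1]
        rw [integral_complex_ofReal]
        congr 1
        simp only [Measure.volumeIoiPow, ENNReal.ofReal]
        rw [integral_withDensity_eq_integral_smul
            (measurable_subtype_coe.pow_const _).real_toNNReal,
          integral_subtype_comap measurableSet_Ioi fun a : ℝ ↦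
            Real.toNNReal (a ^ (2 * d - 1)) • (a ^ (2 * N) * Real.exp (-a ^ 2)),
          setIntegral_congr_fun measurableSet_Ioi
            (g := fun r : ℝ => r ^ ((2 * N + (2 * d - 1) : ℕ) : ℝ) * Real.exp (-r ^ (2 : ℝ)))
            fun x hx ↦ ?_]
        · rw [integral_rpow_mul_exp_neg_rpow two_pos
            (by have : (0 : ℝ) ≤ (2 * N + (2 * d - 1) : ℕ) := Nat.cast_nonneg _
                linarith)]
          have : (((2 * N + (2 * d - 1) : ℕ) : ℝ) + 1) / 2 = N + d := by
            rw [← Nat.cast_add_one, show 2 * N + (2 * d - 1) + 1 = 2 * (N + d) by omega]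
            push_cast
            ring
          rw [this]
          ring
        · simp only
          rw [NNReal.smul_def, Real.coe_toNNReal _ (pow_nonneg (le_of_lt hx) _), Real.rpow_natCast,
            Real.rpow_two, smul_eq_mul, pow_add]
          ring

/-- Uniqueness of Haar measure. The value of the constant is not needed, because it cancels in a
ratio of moments. -/
lemma exists_integral_euclidean_eq (d : ℕ) : ∃ c : ℝ, ∀ f : (Fin d → ℂ) → ℂ,
    ∫ x : EuclideanSpace ℂ (Fin d), f x.ofLp = c * ∫ x : Fin d → ℂ, f x := by
  let L := PiLp.continuousLinearEquiv 2 ℝ (fun _ : Fin d => ℂ)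
  let ν : Measure (Fin d → ℂ) := (volume : Measure (EuclideanSpace ℂ (Fin d))).map L
  have hν : ν.IsAddHaarMeasure := L.isAddHaarMeasure_map _
  refine ⟨Measure.addHaarScalarFactor ν volume, fun f => ?_⟩
  have h1 : ∫ x : EuclideanSpace ℂ (Fin d), f x.ofLp = ∫ x, f x ∂ν :=
    (L.toHomeomorph.measurableEmbedding.integral_map f).symm
  have h2 : ∫ x, f x ∂ν = ∫ x, f x ∂(Measure.addHaarScalarFactor ν volume • volume) :=
    congrArg (fun ρ => ∫ x, f x ∂ρ) (Measure.isAddLeftInvariant_eq_smul ν volume)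
  rw [h1, h2, integral_smul_nnreal_measure]
  rfl

/-- The average over the unit sphere of a product of powers of linear forms. -/
lemma average_sphere_dotProduct_pow (hd : 0 < d) (N : ℕ) (β α : Fin d → ℂ) :
    ⨍ φ : Metric.sphere (0 : EuclideanSpace ℂ (Fin d)) 1,
      (β ⬝ᵥ φ.1.ofLp) ^ N * (star φ.1.ofLp ⬝ᵥ α) ^ N
      ∂(volume : Measure (EuclideanSpace ℂ (Fin d))).toSphere =
    (symDim d N : ℂ)⁻¹ * (β ⬝ᵥ α) ^ N := by
  set σ := (volume : Measure (EuclideanSpace ℂ (Fin d))).toSphere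
  obtain ⟨c, hc⟩ := exists_integral_euclidean_eq d
  have key : ∀ N : ℕ, (∫ φ : Metric.sphere (0 : EuclideanSpace ℂ (Fin d)) 1,
      (β ⬝ᵥ φ.1.ofLp) ^ N * (star φ.1.ofLp ⬝ᵥ α) ^ N ∂σ) * (Real.Gamma (N + d) / 2 : ℝ) =
      c * ((N.factorial * Real.pi ^ d : ℂ) * (β ⬝ᵥ α) ^ N) := by
    intro N
    rw [← integral_dotProduct_pow_mul_exp, ← hc, ← integral_homogeneous_mul_exp hd N
      (fun x => (β ⬝ᵥ x.ofLp) ^ N * (star x.ofLp ⬝ᵥ α) ^ N)]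
    · simp only [EuclideanSpace.norm_sq_eq]
    · intro r x
      have h1 : β ⬝ᵥ (r • x).ofLp = (r : ℂ) * (β ⬝ᵥ x.ofLp) := by
        rw [WithLp.ofLp_smul, dotProduct_smul, Complex.real_smul]
      have h2 : star (r • x).ofLp ⬝ᵥ α = (r : ℂ) * (star x.ofLp ⬝ᵥ α) := by
        rw [WithLp.ofLp_smul, star_smul, smul_dotProduct, star_trivial, Complex.real_smul]
      rw [h1, h2]
      ring
  have : Nonempty (Fin d) := ⟨⟨0, hd⟩⟩
  have harea : σ.real Set.univ ≠ 0 := by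
    rw [measureReal_def, ENNReal.toReal_ne_zero]
    exact ⟨fun h => Measure.toSphere_ne_zero _ (Measure.measure_univ_eq_zero.mp h),
      measure_ne_top _ _⟩
  -- The case N = 0 gives the area of the sphere with the same unknown constant c, so combining it
  -- with the case N eliminates c.
  have h0 := key 0
  have hN := key N
  obtain ⟨e, rfl⟩ : ∃ e, d = e + 1 := ⟨d - 1, by omega⟩
  have hG : ∀ M : ℕ, Real.Gamma (M + (e + 1 : ℕ)) = (M + e).factorial := by
    intro M
    rw [← Real.Gamma_nat_eq_factorial]
    push_cast
    ring_nf
  rw [hG] at h0 hN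
  simp only [pow_zero, mul_one, integral_const, Nat.factorial_zero, Nat.cast_one, one_mul,
    zero_add] at h0
  rw [average_eq]
  have hdim : ((symDim (e + 1) N : ℕ) : ℂ) * (N.factorial * e.factorial) = (N + e).factorial := by
    have := Nat.add_choose_mul_factorial_mul_factorial N e
    rw [symDim, show e + 1 + N - 1 = N + e by omega, Nat.choose_symm_add]
    rw [← this]
    push_cast
    rw [← Nat.choose_symm_add]
    ring
  have hdim0 : ((symDim (e + 1) N : ℕ) : ℂ) ≠ 0 := by
    rw [symDim]; exact_mod_cast (Nat.choose_pos (by omega)).ne'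
  have hsm : ∀ z : ℂ, (σ.real Set.univ)⁻¹ • z = ((σ.real Set.univ : ℝ) : ℂ)⁻¹ * z := by
    intro z; rw [Complex.real_smul]; push_cast; rfl
  have harea' : ((σ.real Set.univ : ℝ) : ℂ) ≠ 0 := Complex.ofReal_ne_zero.mpr harea
  rw [hsm, inv_mul_eq_div, inv_mul_eq_div, div_eq_div_iff harea' hdim0]
  have hf1 : (N.factorial : ℂ) ≠ 0 := by exact_mod_cast N.factorial_ne_zero
  have hf2 : (e.factorial : ℂ) ≠ 0 := by exact_mod_cast e.factorial_ne_zero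
  push_cast at h0 hN
  rw [← hdim] at hN
  rw [Complex.real_smul, mul_one] at h0
  apply mul_right_cancel₀ (mul_ne_zero hf1 hf2)
  linear_combination 2 * hN - 2 * N.factorial * (β ⬝ᵥ α) ^ N * h0

end Sphere

end ExpDeFinetti

end

/-! ### Polarized sphere averages. -/

noncomputable section

namespace ExpDeFinetti

open Matrix MeasureTheory

section Coefficients

open Polynomial

lemma coeff_C_mul_X_add_C_pow (a b : ℂ) (n u : ℕ) :
    ((C b * X + C a : ℂ[X]) ^ n).coeff u = b ^ u * a ^ (n - u) * n.choose u := by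
  have : (C b * X + C a : ℂ[X]) ^ n = ((X + C a) ^ n).comp (C b * X) := by simp
  rw [this, comp_C_mul_X_coeff, coeff_X_add_C_pow]
  ring

/-- The polarization device: an identity valid for all values of a complex parameter can be read
coefficient by coefficient. -/
lemma eq_coeff_of_forall_sum_eq_eval {N : ℕ} {f : ℕ → ℂ} {p : ℂ[X]}
    (h : ∀ s : ℂ, ∑ i ∈ Finset.range (N + 1), s ^ i * f i = p.eval s) {i : ℕ} (hi : i ≤ N) :
    f i = p.coeff i := by
  have hp : ∑ i ∈ Finset.range (N + 1), X ^ i * C (f i) = p := by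
    refine Polynomial.funext fun s => ?_
    rw [← h s, eval_finsetSum]
    simp only [eval_mul, eval_pow, eval_X, eval_C]
  rw [← hp, finsetSum_coeff]
  simp only [mul_comm (X ^ _), coeff_C_mul_X_pow]
  rw [Finset.sum_ite_eq, if_pos (Finset.mem_range.mpr (Nat.lt_succ_of_le hi))]

end Coefficients

section Average

variable {d : ℕ}

/-- The average over the unit sphere of `ℂ^d`. -/
def sphereAvg (d : ℕ) (f : EuclideanSpace ℂ (Fin d) → ℂ) : ℂ :=
  ⨍ φ : Metric.sphere (0 : EuclideanSpace ℂ (Fin d)) 1, f φ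
    ∂(volume : Measure (EuclideanSpace ℂ (Fin d))).toSphere

lemma sphereAvg_const_mul (c : ℂ) (f : EuclideanSpace ℂ (Fin d) → ℂ) :
    sphereAvg d (fun φ => c * f φ) = c * sphereAvg d f := by
  simp only [sphereAvg, average_eq, integral_const_mul]
  rw [mul_smul_comm]

lemma integrable_sphere_of_continuous {f : EuclideanSpace ℂ (Fin d) → ℂ} (hf : Continuous f) :
    Integrable (fun φ : Metric.sphere (0 : EuclideanSpace ℂ (Fin d)) 1 => f φ)
      (volume : Measure (EuclideanSpace ℂ (Fin d))).toSphere := by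
  exact (hf.comp continuous_subtype_val).integrable_of_hasCompactSupport
    (HasCompactSupport.of_compactSpace _)

lemma sphereAvg_sum {ι : Type*} (s : Finset ι) (f : ι → EuclideanSpace ℂ (Fin d) → ℂ)
    (hf : ∀ i ∈ s, Continuous (f i)) :
    sphereAvg d (fun φ => ∑ i ∈ s, f i φ) = ∑ i ∈ s, sphereAvg d (f i) := by
  simp only [sphereAvg, average_eq]
  rw [integral_finsetSum _ fun i hi => integrable_sphere_of_continuous (hf i hi), Finset.smul_sum]

lemma sphereAvg_congr {f g : EuclideanSpace ℂ (Fin d) → ℂ} (h : ∀ φ, ‖φ‖ = 1 → f φ = g φ) :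
    sphereAvg d f = sphereAvg d g := by
  simp only [sphereAvg]
  congr 1
  funext φ
  exact h φ.1 (by simp)

lemma continuous_dotProduct_ofLp (β : Fin d → ℂ) :
    Continuous fun φ : EuclideanSpace ℂ (Fin d) => β ⬝ᵥ φ.ofLp := by
  unfold dotProduct; fun_prop

lemma continuous_star_ofLp_dotProduct (α : Fin d → ℂ) :
    Continuous fun φ : EuclideanSpace ℂ (Fin d) => star φ.ofLp ⬝ᵥ α := by
  unfold dotProduct
  simp only [Pi.star_apply]
  fun_prop

/-- Coefficient of s^i in the moment formula with β replaced by s v + β. -/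
lemma sphereAvg_pow_mul_pow (hd : 0 < d) {N i : ℕ} (hi : i ≤ N) (β v α : Fin d → ℂ) :
    sphereAvg d (fun φ => (v ⬝ᵥ φ.ofLp) ^ i * (β ⬝ᵥ φ.ofLp) ^ (N - i) * (star φ.ofLp ⬝ᵥ α) ^ N) =
      (symDim d N : ℂ)⁻¹ * ((v ⬝ᵥ α) ^ i * (β ⬝ᵥ α) ^ (N - i)) := by
  have hc := continuous_dotProduct_ofLp β
  have hc2 := continuous_dotProduct_ofLp v
  have hc3 := continuous_star_ofLp_dotProduct α
  have h : ∀ s : ℂ, sphereAvg d (fun φ => ((s • v + β) ⬝ᵥ φ.ofLp) ^ N *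
      (star φ.ofLp ⬝ᵥ α) ^ N) = _ := fun s => average_sphere_dotProduct_pow hd N (s • v + β) α
  have h2 := eq_coeff_of_forall_sum_eq_eval (N := N)
    (f := fun i => N.choose i * sphereAvg d (fun φ => (v ⬝ᵥ φ.ofLp) ^ i * (β ⬝ᵥ φ.ofLp) ^ (N - i) *
      (star φ.ofLp ⬝ᵥ α) ^ N))
    (p := Polynomial.C (symDim d N : ℂ)⁻¹ *
      (Polynomial.C (v ⬝ᵥ α) * Polynomial.X + Polynomial.C (β ⬝ᵥ α)) ^ N) (fun s => ?_) hi
  · rw [Polynomial.coeff_C_mul, coeff_C_mul_X_add_C_pow] at h2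
    have hne : (N.choose i : ℂ) ≠ 0 := by exact_mod_cast (Nat.choose_pos hi).ne'
    apply mul_left_cancel₀ hne
    rw [h2]
    ring
  · have h3 : ∀ i, s ^ i * (N.choose i * sphereAvg d (fun φ => (v ⬝ᵥ φ.ofLp) ^ i *
        (β ⬝ᵥ φ.ofLp) ^ (N - i) * (star φ.ofLp ⬝ᵥ α) ^ N)) =
        sphereAvg d (fun φ => (s ^ i * N.choose i) * ((v ⬝ᵥ φ.ofLp) ^ i *
        (β ⬝ᵥ φ.ofLp) ^ (N - i) * (star φ.ofLp ⬝ᵥ α) ^ N)) := by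
      intro i
      rw [sphereAvg_const_mul]; ring
    simp only [h3]
    rw [← sphereAvg_sum _ _ fun i _ => by fun_prop]
    have h4 : (Polynomial.C (symDim d N : ℂ)⁻¹ *
      (Polynomial.C (v ⬝ᵥ α) * Polynomial.X + Polynomial.C (β ⬝ᵥ α)) ^ N).eval s =
      (symDim d N : ℂ)⁻¹ * ((s • v + β) ⬝ᵥ α) ^ N := by
      simp [add_dotProduct, smul_dotProduct, mul_comm s]
    rw [h4, ← h s]
    refine sphereAvg_congr fun φ _ => ?_
    rw [add_dotProduct, smul_dotProduct, smul_eq_mul, add_pow, Finset.sum_mul]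
    refine Finset.sum_congr rfl fun i _ => ?_
    ring

/-- Coefficient of s^j after the further substitution α ↦ s w + α. The right-hand side becomes a
product of an n-th and a j-th power of linear polynomials in s, and u counts the factors s taken
from the n-th power. -/
lemma sphereAvg_mixed (hd : 0 < d) (n j : ℕ) (β v α w : Fin d → ℂ) :
    sphereAvg d (fun φ => (β ⬝ᵥ φ.ofLp) ^ n * (v ⬝ᵥ φ.ofLp) ^ j *
      ((star φ.ofLp ⬝ᵥ α) ^ n * (star φ.ofLp ⬝ᵥ w) ^ j)) =
    (symDim d (n + j) : ℂ)⁻¹ * ((n + j).choose j : ℂ)⁻¹ * ∑ u ∈ Finset.range (j + 1),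
      (n.choose u * j.choose u : ℂ) *
        ((β ⬝ᵥ α) ^ (n - u) * (v ⬝ᵥ α) ^ u * (β ⬝ᵥ w) ^ u * (v ⬝ᵥ w) ^ (j - u)) := by
  set N := n + j
  have hjN : j ≤ N := Nat.le_add_left _ _
  have hNj : N - j = n := Nat.add_sub_cancel _ _
  have hc := continuous_dotProduct_ofLp β
  have hc2 := continuous_dotProduct_ofLp v
  have hc3 := continuous_star_ofLp_dotProduct α
  have hc4 := continuous_star_ofLp_dotProduct w
  have h := fun s : ℂ => sphereAvg_pow_mul_pow hd hjN β v (s • w + α)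
  have h2 := eq_coeff_of_forall_sum_eq_eval (N := N)
    (f := fun i => N.choose i * sphereAvg d (fun φ => (v ⬝ᵥ φ.ofLp) ^ j * (β ⬝ᵥ φ.ofLp) ^ (N - j) *
      ((star φ.ofLp ⬝ᵥ w) ^ i * (star φ.ofLp ⬝ᵥ α) ^ (N - i))))
    (p := Polynomial.C (symDim d N : ℂ)⁻¹ *
      ((Polynomial.C (β ⬝ᵥ w) * Polynomial.X + Polynomial.C (β ⬝ᵥ α)) ^ n *
        (Polynomial.C (v ⬝ᵥ w) * Polynomial.X + Polynomial.C (v ⬝ᵥ α)) ^ j)) (fun s => ?_) hjN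
  · have hne : (N.choose j : ℂ) ≠ 0 := by exact_mod_cast (Nat.choose_pos hjN).ne'
    apply mul_left_cancel₀ hne
    have h3 : sphereAvg d (fun φ => (β ⬝ᵥ φ.ofLp) ^ n * (v ⬝ᵥ φ.ofLp) ^ j *
      ((star φ.ofLp ⬝ᵥ α) ^ n * (star φ.ofLp ⬝ᵥ w) ^ j)) =
      sphereAvg d (fun φ => (v ⬝ᵥ φ.ofLp) ^ j * (β ⬝ᵥ φ.ofLp) ^ (N - j) *
      ((star φ.ofLp ⬝ᵥ w) ^ j * (star φ.ofLp ⬝ᵥ α) ^ (N - j))) :=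
      sphereAvg_congr fun φ _ => by rw [hNj]; ring
    rw [h3, h2, Polynomial.coeff_C_mul, Polynomial.coeff_mul,
      Finset.Nat.sum_antidiagonal_eq_sum_range_succ_mk, mul_comm (symDim d N : ℂ)⁻¹ (_⁻¹),
      mul_assoc, mul_inv_cancel_left₀ hne]
    congr 1
    refine Finset.sum_congr rfl fun u hu => ?_
    have huj : u ≤ j := Nat.lt_succ_iff.mp (Finset.mem_range.mp hu)
    simp only [coeff_C_mul_X_add_C_pow]
    rw [Nat.choose_symm huj, Nat.sub_sub_self huj]
    ring
  · have h3 : ∀ i, s ^ i * (N.choose i * sphereAvg d (fun φ => (v ⬝ᵥ φ.ofLp) ^ j *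
        (β ⬝ᵥ φ.ofLp) ^ (N - j) * ((star φ.ofLp ⬝ᵥ w) ^ i * (star φ.ofLp ⬝ᵥ α) ^ (N - i)))) =
        sphereAvg d (fun φ => (s ^ i * N.choose i) * ((v ⬝ᵥ φ.ofLp) ^ j *
        (β ⬝ᵥ φ.ofLp) ^ (N - j) * ((star φ.ofLp ⬝ᵥ w) ^ i * (star φ.ofLp ⬝ᵥ α) ^ (N - i)))) := by
      intro i
      rw [sphereAvg_const_mul]; ring
    simp only [h3]
    rw [← sphereAvg_sum _ _ fun i _ => by fun_prop]
    have h4 : (Polynomial.C (symDim d N : ℂ)⁻¹ *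
      ((Polynomial.C (β ⬝ᵥ w) * Polynomial.X + Polynomial.C (β ⬝ᵥ α)) ^ n *
        (Polynomial.C (v ⬝ᵥ w) * Polynomial.X + Polynomial.C (v ⬝ᵥ α)) ^ j)).eval s =
      (symDim d N : ℂ)⁻¹ * ((v ⬝ᵥ (s • w + α)) ^ j * (β ⬝ᵥ (s • w + α)) ^ (N - j)) := by
      rw [hNj]
      simp [dotProduct_add, dotProduct_smul, mul_comm s]
      left; ring
    rw [h4, ← h s]
    refine sphereAvg_congr fun φ _ => ?_
    rw [dotProduct_add, dotProduct_smul, smul_eq_mul, add_pow, Finset.mul_sum]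
    refine Finset.sum_congr rfl fun i _ => ?_
    ring

lemma dotProduct_avgPurePow_mulVec (d n : ℕ) (x y : (Fin n → Fin d) → ℂ) :
    x ⬝ᵥ avgPurePow d n *ᵥ y =
      sphereAvg d (fun φ => (x ⬝ᵥ tpow n φ.ofLp) * (tpow n (star φ.ofLp) ⬝ᵥ y)) := by
  have h : ∀ φ : EuclideanSpace ℂ (Fin d), (x ⬝ᵥ tpow n φ.ofLp) * (tpow n (star φ.ofLp) ⬝ᵥ y) =
      ∑ i, ∑ j, (x i * y j) * purePow d n φ i j := by
    intro φ
    rw [dotProduct, dotProduct, Finset.sum_mul_sum]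
    refine Finset.sum_congr rfl fun i _ => Finset.sum_congr rfl fun j _ => ?_
    simp only [tpow, purePow, of_apply, Finset.prod_mul_distrib, Pi.star_apply]
    ring
  have hc : ∀ i j, Continuous fun φ => purePow d n φ i j := by
    intro i j
    simp only [purePow, of_apply]
    fun_prop
  simp only [h]
  rw [sphereAvg_sum _ _ fun i _ => by fun_prop, dotProduct]
  refine Finset.sum_congr rfl fun i _ => ?_
  rw [sphereAvg_sum _ _ fun j _ => by fun_prop, mulVec, dotProduct, Finset.mul_sum]
  refine Finset.sum_congr rfl fun j _ => ?_
  rw [sphereAvg_const_mul]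
  change x i * (sphereAvg d (fun φ => purePow d n φ i j) * y j) = _
  ring

lemma ext_of_dotProduct_mulVec {ι : Type*} [Fintype ι] [DecidableEq ι] {A B : Matrix ι ι ℂ}
    (h : ∀ x y, x ⬝ᵥ A *ᵥ y = x ⬝ᵥ B *ᵥ y) : A = B := by
  ext i j
  have := h (Pi.single i 1) (Pi.single j 1)
  simpa using this

/-- The projector onto the symmetric subspace as an average of pure product states. -/
lemma symProj_eq_smul_avgPurePow {d : ℕ} (hd : 0 < d) (n : ℕ) :
    symProj d n = (symDim d n : ℂ) • avgPurePow d n := by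
  have hne : (symDim d n : ℂ) ≠ 0 := by
    rw [symDim]; exact_mod_cast (Nat.choose_pos (by omega)).ne'
  refine ext_of_tpow (by rw [symProj_mul_symProj, symProj_mul_symProj]) ?_ fun v w => ?_
  · rw [mul_smul_comm, smul_mul_assoc]
    congr 1
    -- The average absorbs the projector on both sides because every tensor power is fixed by it.
    refine ext_of_dotProduct_mulVec fun x y => ?_
    rw [mul_assoc, ← mulVec_mulVec, dotProduct_mulVec x (symProj d n), ← mulVec_mulVec,
      dotProduct_avgPurePow_mulVec, dotProduct_avgPurePow_mulVec]
    simp only [dotProduct_mulVec, tpow_vecMul_symProj]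
    simp only [← dotProduct_mulVec, symProj_mulVec_tpow]
  · rw [symProj_mulVec_tpow, smul_mulVec, dotProduct_smul, dotProduct_avgPurePow_mulVec]
    simp only [tpow_dotProduct_tpow]
    have := average_sphere_dotProduct_pow hd n v w
    rw [show sphereAvg d (fun φ => (v ⬝ᵥ φ.ofLp) ^ n * (star φ.ofLp ⬝ᵥ w) ^ n) = _ from this,
      smul_eq_mul, mul_inv_cancel_left₀ hne]

end Average

/-! ### Tensor products of vectors across a split of the systems. -/

section Split

variable {d a m b : ℕ}

lemma sum_splitEquiv {M : Type*} [AddCommMonoid M] (h : a + m = b) (f : (Fin b → Fin d) → M) :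
    ∑ p, f p = ∑ s, ∑ t, f ((splitEquiv d h).symm (s, t)) := by
  rw [← Equiv.sum_comp (splitEquiv d h).symm, Fintype.sum_prod_type]

lemma tpow_splitEquiv_symm (h : a + m = b) (α : Fin d → ℂ) (s : Fin a → Fin d) (t : Fin m → Fin d) :
    tpow b α ((splitEquiv d h).symm (s, t)) = tpow a α s * tpow m α t := by
  subst h
  change ∏ l : Fin (a + m), α (Fin.append s t l) = _
  rw [Fin.prod_univ_add]
  simp only [Fin.append_left, Fin.append_right, tpow]

/-- The tensor product of two vectors. -/
def tmul (h : a + m = b) (x : (Fin a → Fin d) → ℂ) (y : (Fin m → Fin d) → ℂ) :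
    (Fin b → Fin d) → ℂ :=
  fun p => x (splitEquiv d h p).1 * y (splitEquiv d h p).2

lemma tmul_splitEquiv_symm (h : a + m = b) (x : (Fin a → Fin d) → ℂ) (y : (Fin m → Fin d) → ℂ)
    (s : Fin a → Fin d) (t : Fin m → Fin d) :
    tmul h x y ((splitEquiv d h).symm (s, t)) = x s * y t := by
  rw [tmul, Equiv.apply_symm_apply]

lemma tmul_tpow (h : a + m = b) (α : Fin d → ℂ) : tmul h (tpow a α) (tpow m α) = tpow b α := by
  ext p
  obtain ⟨⟨s, t⟩, rfl⟩ := (splitEquiv d h).symm.surjective p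
  rw [tmul_splitEquiv_symm, tpow_splitEquiv_symm]

lemma tmul_dotProduct_tmul (h : a + m = b) (x x' : (Fin a → Fin d) → ℂ)
    (y y' : (Fin m → Fin d) → ℂ) :
    tmul h x y ⬝ᵥ tmul h x' y' = (x ⬝ᵥ x') * (y ⬝ᵥ y') := by
  rw [dotProduct, sum_splitEquiv h, dotProduct, dotProduct, Finset.sum_mul_sum]
  refine Finset.sum_congr rfl fun s _ => Finset.sum_congr rfl fun t _ => ?_
  rw [tmul_splitEquiv_symm, tmul_splitEquiv_symm]
  ring

lemma padId_mulVec_tmul (h : a + m = b) (ρ : Op d a) (x : (Fin a → Fin d) → ℂ)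
    (y : (Fin m → Fin d) → ℂ) : padId d h ρ *ᵥ tmul h x y = tmul h (ρ *ᵥ x) y := by
  ext p
  obtain ⟨⟨s, t⟩, rfl⟩ := (splitEquiv d h).symm.surjective p
  rw [tmul_splitEquiv_symm, mulVec, dotProduct, sum_splitEquiv h, mulVec, dotProduct,
    Finset.sum_mul]
  refine Finset.sum_congr rfl fun s' _ => ?_
  rw [Finset.sum_eq_single t]
  · rw [tmul_splitEquiv_symm, padId, submatrix_apply, Equiv.apply_symm_apply,
      Equiv.apply_symm_apply, kroneckerMap_apply, one_apply_eq]
    ring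
  · intro t' _ ht
    rw [padId, submatrix_apply, Equiv.apply_symm_apply, Equiv.apply_symm_apply,
      kroneckerMap_apply, one_apply_ne ht.symm, mul_zero, zero_mul]
  · simp

end Split

end ExpDeFinetti

end

/-! ### Partial trace and cloning as trace-norm contractions. -/

noncomputable section

namespace ExpDeFinetti

open Matrix MeasureTheory

variable {d a m b : ℕ}

lemma symDim_ne_zero (hd : 0 < d) (n : ℕ) : (symDim d n : ℂ) ≠ 0 := by
  rw [symDim]; exact_mod_cast (Nat.choose_pos (by omega)).ne'

lemma traceLast_avgPurePow (h : a + m = b) :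
    traceLast d h (avgPurePow d b) = avgPurePow d a := by
  ext i j
  have hc : ∀ p q, Continuous fun φ => purePow d b φ p q := by
    intro p q
    simp only [purePow, of_apply]
    fun_prop
  change ∑ t : Fin m → Fin d, sphereAvg d (fun φ => purePow d b φ ((splitEquiv d h).symm (i, t))
    ((splitEquiv d h).symm (j, t))) = sphereAvg d (fun φ => purePow d a φ i j)
  rw [← sphereAvg_sum _ _ fun t _ => hc _ _]
  refine sphereAvg_congr fun φ hφ => ?_
  have hp : ∀ (n : ℕ) (p q : Fin n → Fin d),
      purePow d n φ p q = tpow n φ.ofLp p * tpow n (star φ.ofLp) q := by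
    intro n p q
    simp only [tpow, purePow, of_apply, Finset.prod_mul_distrib, Pi.star_apply]
  have h1 : tpow m φ.ofLp ⬝ᵥ tpow m (star φ.ofLp) = 1 := by
    rw [tpow_dotProduct_tpow, dotProduct_comm, ← l2_sq_eq_dotProduct, l2]
    change (((‖φ‖ ^ 2 : ℝ) : ℂ)) ^ m = 1
    rw [hφ]; simp
  simp only [hp, tpow_splitEquiv_symm]
  rw [← mul_one (tpow a φ.ofLp i * _), ← h1, dotProduct, Finset.mul_sum]
  exact Finset.sum_congr rfl fun t _ => mul_mul_mul_comm _ _ _ _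

lemma traceLast_symProj (hd : 0 < d) (h : a + m = b) :
    traceLast d h (symProj d b) = ((symDim d b : ℂ) / symDim d a) • symProj d a := by
  rw [symProj_eq_smul_avgPurePow hd, symProj_eq_smul_avgPurePow hd, map_smul,
    traceLast_avgPurePow, smul_smul, div_mul_cancel₀ _ (symDim_ne_zero hd a)]

/-- The matrix `1 ⊗ |t⟩` of the isometry which adjoins a basis state. -/
def adjoin (d : ℕ) (h : a + m = b) (t : Fin m → Fin d) :
    Matrix (Fin b → Fin d) (Fin a → Fin d) ℂ :=
  of fun p s => if splitEquiv d h p = (s, t) then 1 else 0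

lemma adjoin_splitEquiv_symm (h : a + m = b) (s s' : Fin a → Fin d) (t t' : Fin m → Fin d) :
    adjoin d h t ((splitEquiv d h).symm (s, t')) s' = if s = s' then if t' = t then 1 else 0 else 0 := by
  simp only [adjoin, of_apply, Equiv.apply_symm_apply, Prod.mk.injEq, ite_and]

lemma conjTranspose_adjoin_mul_mul_adjoin (h : a + m = b) (X : Op d b) (t : Fin m → Fin d)
    (i j : Fin a → Fin d) : ((adjoin d h t)ᴴ * X * adjoin d h t) i j =
      X ((splitEquiv d h).symm (i, t)) ((splitEquiv d h).symm (j, t)) := by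
  rw [mul_apply, sum_splitEquiv h]
  simp only [adjoin_splitEquiv_symm, mul_ite, mul_one, mul_zero, Finset.sum_ite_irrel,
    Finset.sum_const_zero, Finset.sum_ite_eq', Finset.mem_univ, if_true]
  rw [mul_apply, sum_splitEquiv h]
  simp only [conjTranspose_apply, adjoin_splitEquiv_symm, apply_ite star, star_one, star_zero,
    ite_mul, one_mul, zero_mul, Finset.sum_ite_irrel,
    Finset.sum_const_zero, Finset.sum_ite_eq', Finset.mem_univ, if_true]

lemma traceLast_eq_sum (h : a + m = b) (X : Op d b) :
    traceLast d h X = ∑ t, (adjoin d h t)ᴴ * X * adjoin d h t := by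
  ext i j
  rw [Matrix.sum_apply]
  exact Finset.sum_congr rfl fun t _ => (conjTranspose_adjoin_mul_mul_adjoin h X t i j).symm

lemma padId_eq_sum (h : a + m = b) (ρ : Op d a) :
    padId d h ρ = ∑ t, adjoin d h t * ρ * (adjoin d h t)ᴴ := by
  ext p q
  obtain ⟨⟨s, t⟩, rfl⟩ := (splitEquiv d h).symm.surjective p
  obtain ⟨⟨s', t'⟩, rfl⟩ := (splitEquiv d h).symm.surjective q
  rw [padId, submatrix_apply, Equiv.apply_symm_apply, Equiv.apply_symm_apply, kroneckerMap_apply,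
    Matrix.sum_apply]
  simp only [mul_apply, conjTranspose_apply, adjoin_splitEquiv_symm, apply_ite star, star_one,
    star_zero, ite_mul, one_mul, zero_mul, mul_ite, mul_one, mul_zero, Finset.sum_ite_eq,
    Finset.mem_univ, if_true, one_apply]

lemma sum_l2_sq_conjTranspose_adjoin (h : a + m = b) (v : (Fin b → Fin d) → ℂ) :
    ∑ t, l2 ((adjoin d h t)ᴴ *ᵥ v) ^ 2 = l2 v ^ 2 := by
  simp only [l2_sq]
  rw [sum_splitEquiv h (fun p => ‖v p‖ ^ 2), Finset.sum_comm]
  refine Finset.sum_congr rfl fun s _ => Finset.sum_congr rfl fun t _ => ?_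
  congr 2
  rw [mulVec, dotProduct, sum_splitEquiv h]
  simp only [conjTranspose_apply, adjoin_splitEquiv_symm, apply_ite star, star_one, star_zero,
    ite_mul, one_mul, zero_mul, Finset.sum_ite_irrel,
    Finset.sum_const_zero, Finset.sum_ite_eq', Finset.mem_univ, if_true]

lemma traceNorm_ampliate_traceLast_le (h : a + m = b) (l : ℕ)
    (X : Matrix ((Fin b → Fin d) × Fin l) ((Fin b → Fin d) × Fin l) ℂ) :
    traceNorm (ampliate (traceLast d h) l X) ≤ traceNorm X :=
  traceNorm_ampliate_le_of_kraus _ (fun t => (adjoin d h t)ᴴ)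
    (fun X => by simp only [conjTranspose_conjTranspose, traceLast_eq_sum])
    (fun v => (sum_l2_sq_conjTranspose_adjoin h v).le) l X

lemma l2_symProj_mulVec_le (n : ℕ) (v : (Fin n → Fin d) → ℂ) :
    l2 (symProj d n *ᵥ v) ≤ l2 v := by
  have h : ((l2 (symProj d n *ᵥ v) ^ 2 : ℝ) : ℂ) = star v ⬝ᵥ symProj d n *ᵥ v := by
    rw [l2_sq_eq_dotProduct, star_mulVec, symProj_conjTranspose, ← dotProduct_mulVec, mulVec_mulVec,
      symProj_mul_symProj]
  have h2 : l2 (symProj d n *ᵥ v) ^ 2 ≤ l2 v * l2 (symProj d n *ᵥ v) := by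
    rw [← Real.norm_of_nonneg (sq_nonneg (l2 (symProj d n *ᵥ v))), ← Complex.norm_real, h,
      ← inner_toLp]
    exact norm_inner_le_norm _ _
  by_contra hlt
  push Not at hlt
  have := l2_nonneg v
  nlinarith

/-- The operators Π_b (1 ⊗ |t⟩) are the Kraus operators of cloning before normalization. Their sum ∑
K†K is the partial trace of Π_b, which equals (d[b]/d[a]) Π_a. -/
lemma sum_l2_sq_symProj_adjoin (hd : 0 < d) (h : a + m = b) (v : (Fin a → Fin d) → ℂ) :
    ∑ t, l2 ((symProj d b * adjoin d h t) *ᵥ v) ^ 2 ≤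
      ((symDim d b : ℝ) / symDim d a) * l2 v ^ 2 := by
  have key : ((∑ t, l2 ((symProj d b * adjoin d h t) *ᵥ v) ^ 2 : ℝ) : ℂ) =
      (((symDim d b : ℝ) / symDim d a * l2 (symProj d a *ᵥ v) ^ 2 : ℝ) : ℂ) := by
    have h1 : ∀ t, ((l2 ((symProj d b * adjoin d h t) *ᵥ v) ^ 2 : ℝ) : ℂ) =
        star v ⬝ᵥ ((adjoin d h t)ᴴ * symProj d b * adjoin d h t) *ᵥ v := by
      intro t
      rw [l2_sq_eq_dotProduct, star_mulVec, conjTranspose_mul, symProj_conjTranspose,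
        ← dotProduct_mulVec, mulVec_mulVec, Matrix.mul_assoc,
        ← Matrix.mul_assoc (symProj d b), symProj_mul_symProj, Matrix.mul_assoc]
    rw [Complex.ofReal_sum]
    simp only [h1]
    rw [← dotProduct_sum, ← sum_mulVec, ← traceLast_eq_sum, traceLast_symProj hd, smul_mulVec,
      dotProduct_smul, Complex.ofReal_mul, l2_sq_eq_dotProduct, star_mulVec, symProj_conjTranspose,
      ← dotProduct_mulVec, mulVec_mulVec, symProj_mul_symProj, smul_eq_mul]
    push_cast
    rfl
  rw [Complex.ofReal_inj.mp key]
  gcongr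
  · exact l2_nonneg _
  · exact l2_symProj_mulVec_le a v

lemma traceNorm_ampliate_Clone_le (hd : 0 < d) (h : a + m = b) (l : ℕ)
    (X : Matrix ((Fin a → Fin d) × Fin l) ((Fin a → Fin d) × Fin l) ℂ) :
    traceNorm (ampliate (Clone d h) l X) ≤ traceNorm X := by
  set c : ℝ := (symDim d a : ℝ) / symDim d b
  have hc : 0 ≤ c := by positivity
  have ha : (symDim d a : ℝ) ≠ 0 := by exact_mod_cast symDim_ne_zero hd a
  have hb : (symDim d b : ℝ) ≠ 0 := by exact_mod_cast symDim_ne_zero hd b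
  refine traceNorm_ampliate_le_of_kraus _
    (fun t => ((√c : ℝ) : ℂ) • (symProj d b * adjoin d h t)) (fun ρ => ?_) (fun v => ?_) l X
  · have h1 : ((√c : ℝ) : ℂ) * ((√c : ℝ) : ℂ) = (symDim d a : ℂ) / symDim d b := by
      rw [← Complex.ofReal_mul, Real.mul_self_sqrt hc]
      simp [c]
    change ((symDim d a : ℂ) / symDim d b) • (symProj d b * padId d h ρ * symProj d b) = _
    rw [padId_eq_sum, Matrix.mul_sum, Matrix.sum_mul, Finset.smul_sum]
    refine Finset.sum_congr rfl fun t _ => ?_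
    rw [conjTranspose_smul, conjTranspose_mul, symProj_conjTranspose, Matrix.smul_mul,
      Matrix.mul_smul, Matrix.smul_mul, smul_smul]
    simp only [RCLike.star_def, Complex.conj_ofReal, h1, Matrix.mul_assoc]
  · simp only [smul_mulVec, l2_smul, mul_pow, ← Finset.mul_sum, Complex.norm_real,
      Real.norm_eq_abs, sq_abs, Real.sq_sqrt hc]
    refine (mul_le_mul_of_nonneg_left (sum_l2_sq_symProj_adjoin hd h v) hc).trans (le_of_eq ?_)
    simp only [c]
    field_simp

lemma ampliate_comp {ι κ μ : Type*} (Φ : Matrix κ κ ℂ →ₗ[ℂ] Matrix μ μ ℂ)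
    (Ψ : Matrix ι ι ℂ →ₗ[ℂ] Matrix κ κ ℂ) (l : ℕ)
    (X : Matrix (ι × Fin l) (ι × Fin l) ℂ) :
    ampliate (Φ ∘ₗ Ψ) l X = ampliate Φ l (ampliate Ψ l X) := rfl

/-! ### Matrix elements of the three maps between tensor powers. -/

section MatrixElements

lemma traceLast_vecMulVec_tpow (h : a + m = b) (α β : Fin d → ℂ) :
    traceLast d h (vecMulVec (tpow b α) (tpow b β)) =
      (β ⬝ᵥ α) ^ m • vecMulVec (tpow a α) (tpow a β) := by
  ext i j
  rw [dotProduct_comm, ← tpow_dotProduct_tpow, Matrix.smul_apply, vecMulVec_apply, smul_eq_mul,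
    dotProduct, Finset.sum_mul]
  refine Finset.sum_congr rfl fun t _ => ?_
  rw [vecMulVec_apply, tpow_splitEquiv_symm, tpow_splitEquiv_symm]
  ring

lemma dotProduct_Clone_mulVec (h : a + m = b) (ρ : Op d a) (v w : Fin d → ℂ) :
    tpow b v ⬝ᵥ Clone d h ρ *ᵥ tpow b w =
      ((symDim d a : ℂ) / symDim d b) * (v ⬝ᵥ w) ^ m * (tpow a v ⬝ᵥ ρ *ᵥ tpow a w) := by
  change tpow b v ⬝ᵥ (((symDim d a : ℂ) / symDim d b) •
    (symProj d b * padId d h ρ * symProj d b)) *ᵥ tpow b w = _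
  rw [smul_mulVec, dotProduct_smul, ← mulVec_mulVec, symProj_mulVec_tpow, ← mulVec_mulVec,
    dotProduct_mulVec _ (symProj d b), tpow_vecMul_symProj, ← tmul_tpow h w, padId_mulVec_tmul,
    ← tmul_tpow h v, tmul_dotProduct_tmul, tpow_dotProduct_tpow, smul_eq_mul]
  ring

lemma symProj_mul_Clone_mul_symProj (h : a + m = b) (ρ : Op d a) :
    symProj d b * Clone d h ρ * symProj d b = Clone d h ρ := by
  have key : ∀ (c : ℂ) (Y : Op d b), symProj d b * (c • (symProj d b * Y * symProj d b)) *
      symProj d b = c • (symProj d b * Y * symProj d b) := by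
    intro c Y
    rw [Matrix.mul_smul, Matrix.smul_mul]
    simp only [← Matrix.mul_assoc, symProj_mul_symProj]
    rw [Matrix.mul_assoc (symProj d b * Y), symProj_mul_symProj]
  exact key _ _

lemma dotProduct_traceFirst_mulVec (h : a + m = b) (X : Op d b) (x y : (Fin m → Fin d) → ℂ) :
    x ⬝ᵥ traceFirst d h X *ᵥ y =
      ∑ t, tmul h (Pi.single t 1) x ⬝ᵥ X *ᵥ tmul h (Pi.single t 1) y := by
  have h1 : ∀ (t : Fin a → Fin d) (z : (Fin m → Fin d) → ℂ) (f : (Fin b → Fin d) → ℂ),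
      tmul h (Pi.single t 1) z ⬝ᵥ f = ∑ i, z i * f ((splitEquiv d h).symm (t, i)) := by
    intro t z f
    rw [dotProduct, sum_splitEquiv h, Finset.sum_eq_single t]
    · simp [tmul_splitEquiv_symm]
    · intro s _ hs
      simp [tmul_splitEquiv_symm, hs]
    · simp
  simp only [mulVec, dotProduct_comm _ (tmul h _ y), h1]
  simp only [dotProduct]
  rw [Finset.sum_comm]
  refine Finset.sum_congr rfl fun i _ => ?_
  rw [← Finset.mul_sum, Finset.sum_comm]
  congr 1
  refine Finset.sum_congr rfl fun j _ => ?_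
  rw [← Finset.mul_sum, mul_comm]
  rfl

/-- Pairing the definition with tensor powers leaves exactly the average in `sphereAvg_mixed`. The
u-th monomial is, up to d[j]/d[u], the matrix element of Clone_{u→j} ∘ tr_{n-u}. -/
lemma dotProduct_MP_mulVec (hd : 0 < d) (n j : ℕ) (β v α w : Fin d → ℂ) :
    tpow j v ⬝ᵥ MP d n j (vecMulVec (tpow n α) (tpow n β)) *ᵥ tpow j w =
      (symDim d n : ℂ) * ((symDim d (n + j) : ℂ)⁻¹ * ((n + j).choose j : ℂ)⁻¹ *
        ∑ u ∈ Finset.range (j + 1), (n.choose u * j.choose u : ℂ) *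
        ((β ⬝ᵥ α) ^ (n - u) * (v ⬝ᵥ α) ^ u * (β ⬝ᵥ w) ^ u * (v ⬝ᵥ w) ^ (j - u))) := by
  rw [← sphereAvg_mixed hd]
  change tpow j v ⬝ᵥ traceFirst d rfl ((symDim d n : ℂ) • (avgPurePow d (n + j) *
    padId d rfl (vecMulVec (tpow n α) (tpow n β)))) *ᵥ tpow j w = _
  rw [map_smul, smul_mulVec, dotProduct_smul, smul_eq_mul, dotProduct_traceFirst_mulVec]
  congr 1
  have h1 : ∀ t : Fin n → Fin d,
      tmul rfl (Pi.single t 1) (tpow j v) ⬝ᵥ (avgPurePow d (n + j) *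
        padId d rfl (vecMulVec (tpow n α) (tpow n β))) *ᵥ tmul rfl (Pi.single t 1) (tpow j w) =
      tpow n β t * (tmul rfl (Pi.single t 1) (tpow j v) ⬝ᵥ avgPurePow d (n + j) *ᵥ
        tmul rfl (tpow n α) (tpow j w)) := by
    intro t
    rw [← mulVec_mulVec, padId_mulVec_tmul, vecMulVec_mulVec, op_smul_eq_smul]
    have : tmul (rfl : n + j = n + j) ((tpow n β ⬝ᵥ Pi.single t 1) • tpow n α) (tpow j w) =
        tpow n β t • tmul rfl (tpow n α) (tpow j w) := by
      ext p
      simp [tmul, mul_assoc]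
    rw [this, mulVec_smul, dotProduct_smul, smul_eq_mul]
  simp only [h1]
  -- Summing over the traced basis reassembles the vector β^{⊗n}.
  have h2 : ∑ t, tpow n β t * (tmul rfl (Pi.single t 1) (tpow j v) ⬝ᵥ avgPurePow d (n + j) *ᵥ
        tmul rfl (tpow n α) (tpow j w)) =
      tmul rfl (tpow n β) (tpow j v) ⬝ᵥ avgPurePow d (n + j) *ᵥ
        tmul rfl (tpow n α) (tpow j w) := by
    have : tmul (rfl : n + j = n + j) (tpow n β) (tpow j v) =
        ∑ t, tpow n β t • tmul (rfl : n + j = n + j) (Pi.single t 1) (tpow j v) := by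
      ext p
      simp [tmul, Finset.sum_apply, Pi.single_apply]
    rw [this, sum_dotProduct]
    simp only [smul_dotProduct, smul_eq_mul]
  rw [h2, dotProduct_avgPurePow_mulVec]
  congr 1
  funext φ
  rw [← tmul_tpow (rfl : n + j = n + j) φ.ofLp, ← tmul_tpow (rfl : n + j = n + j) (star φ.ofLp),
    tmul_dotProduct_tmul, tmul_dotProduct_tmul]
  simp only [tpow_dotProduct_tpow]

end MatrixElements

end ExpDeFinetti

end

/-! ### The coefficients of the expansion. -/

noncomputable section

namespace ExpDeFinetti

open Nat

/-- By Pascal's rule the truncated alternating sum telescopes. Its vanishing for t < r is what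
removes the terms of low order. -/
lemma sum_range_neg_one_pow_mul_choose (t r : ℕ) :
    ∑ s ∈ Finset.range (r + 1), (-1 : ℝ) ^ s * (t + 1).choose s = (-1) ^ r * t.choose r := by
  induction r with
  | zero => simp
  | succ r ih =>
    rw [Finset.sum_range_succ, ih, Nat.choose_succ_succ]
    push_cast
    ring

lemma choose_le_factorial (n k : ℕ) : n.choose k ≤ n ! := by
  rcases le_or_gt k n with h | h
  · rw [← Nat.choose_mul_factorial_mul_factorial h, mul_assoc]
    exact Nat.le_mul_of_pos_right _ (Nat.mul_pos k.factorial_pos (n - k).factorial_pos)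
  · rw [Nat.choose_eq_zero_of_lt h]; exact Nat.zero_le _

lemma symDim_succ (e n : ℕ) : (symDim (e + 1) n : ℝ) = (e + n)! / (e ! * n !) := by
  rw [symDim, show e + 1 + n - 1 = e + n by omega, ← Nat.choose_symm_add, Nat.cast_add_choose]

/-- The first factor of the coefficient of `Clone_{i→j} ∘ tr_{n-i}` in `MP_{n→j}`, which is
`coefA j * coefB i / (j - i)!`, in local dimension `e + 1`. -/
def coefA (e n j : ℕ) : ℝ := (e + j)! * j ! * (e + n)! / (e + n + j)!

/-- The second factor of the coefficient of `Clone_{i→j} ∘ tr_{n-i}` in `MP_{n→j}`. -/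
def coefB (e n i : ℕ) : ℝ := n.choose i / (e + i)!

/-- The coefficients of the de Finetti expansion. -/
def coefX (e n k s : ℕ) : ℝ := (-1) ^ s / (s ! * coefA e n (k - s) * coefB e n k)

/-- The coefficients of the remainder of the de Finetti expansion. -/
def coefG (e n k r t : ℕ) : ℝ :=
  (if t = 0 then 1 else 0) - coefB e n (k - t) / coefB e n k / t ! *
    ∑ s ∈ Finset.range (r + 1), (-1 : ℝ) ^ s * t.choose s

lemma coefA_pos (e n j : ℕ) : 0 < coefA e n j := by unfold coefA; positivity

lemma coefB_pos (e : ℕ) {n i : ℕ} (h : i ≤ n) : 0 < coefB e n i := by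
  have := Nat.choose_pos h
  unfold coefB; positivity

/-- The factorization of the coefficients into a j-part and a u-part, on which the choice of `coefX`
rests. The factor d[j] on the left comes from the normalization of the cloning map applied
afterwards. -/
lemma coefMP_eq (e n : ℕ) {j u : ℕ} (hu : u ≤ j) :
    (symDim (e + 1) j : ℝ) * symDim (e + 1) n /
      (symDim (e + 1) (n + j) * (n + j).choose j) * (n.choose u * j.choose u) =
    coefA e n j * coefB e n u / (j - u)! * symDim (e + 1) u := by
  have h1 : ((n + j).choose j : ℝ) = (n + j)! / (n ! * j !) := by
    rw [← Nat.choose_symm_add, Nat.cast_add_choose]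
  have h2 : (j.choose u : ℝ) = j ! / (u ! * (j - u)!) := Nat.cast_choose ℝ hu
  rw [symDim_succ, symDim_succ, symDim_succ, symDim_succ, h1, h2, coefA, coefB, ← add_assoc]
  field_simp

/-- `coefX` cancels A_{k-s}, and the remaining 1 / (s! (k-u-s)!) is C(k-u,s) / (k-u)!, which gives
the signed binomial. -/
lemma coefX_mul_coefMP (e n : ℕ) {k u s : ℕ} (hk : k ≤ n) (hu : u ≤ k) (hs : s ≤ k) :
    coefX e n k s * ((symDim (e + 1) (k - s) : ℝ) * symDim (e + 1) n /
      (symDim (e + 1) (n + (k - s)) * (n + (k - s)).choose (k - s)) *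
        (n.choose u * (k - s).choose u)) =
    coefB e n u / coefB e n k / (k - u)! * ((-1) ^ s * (k - u).choose s) * symDim (e + 1) u := by
  rcases le_or_gt u (k - s) with h | h
  · rw [coefMP_eq e n h, Nat.cast_choose ℝ (by omega : s ≤ k - u), coefX,
      show k - s - u = k - u - s by omega]
    have ha := (coefA_pos e n (k - s)).ne'
    have hb := (coefB_pos e hk).ne'
    field_simp
  · rw [Nat.choose_eq_zero_of_lt h, Nat.choose_eq_zero_of_lt (by omega : k - u < s)]
    simp

/-- The expansion with coefficients `coefX` has remainder coefficients `coefG`. -/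
lemma coefG_mul_symDim (e n : ℕ) {k u r : ℕ} (hk : k ≤ n) (hr : r ≤ k) (hu : u ≤ k) :
    (if u = k then (symDim (e + 1) k : ℝ) else 0) - ∑ s ∈ Finset.range (r + 1),
      coefX e n k s * ((symDim (e + 1) (k - s) : ℝ) * symDim (e + 1) n /
      (symDim (e + 1) (n + (k - s)) * (n + (k - s)).choose (k - s)) *
        (n.choose u * (k - s).choose u)) =
    coefG e n k r (k - u) * symDim (e + 1) u := by
  rw [coefG, sub_mul, Nat.sub_sub_self hu, Finset.mul_sum, Finset.sum_mul]
  congr 1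
  · by_cases h : u = k
    · rw [if_pos h, if_pos (by omega), h, one_mul]
    · rw [if_neg h, if_neg (by omega), zero_mul]
  · refine Finset.sum_congr rfl fun s hs => ?_
    rw [coefX_mul_coefMP e n hk hu ((Nat.lt_succ_iff.mp (Finset.mem_range.mp hs)).trans hr)]

/-! ### Estimates for the coefficients. -/

section Bounds

variable {e n k : ℕ} {δ : ℝ}

/-- The ratio B_i / B_{i+1} equals (i+1)(e+i+1)/(n-i). -/
lemma coefB_le_mul_coefB_succ (hk : k ≤ n) (hδ : (k : ℝ) * ((e + 1 : ℕ) + k) ≤ δ * n)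
    (hδ1 : δ < 1) {i : ℕ} (hi : i < k) : coefB e n i ≤ δ * coefB e n (i + 1) := by
  have hc : (n.choose (i + 1) : ℝ) * (i + 1) = n.choose i * (n - i) := by
    have := Nat.choose_succ_right_eq n i
    rw [← Nat.cast_sub (by omega : i ≤ n)]
    exact_mod_cast this
  have hik : (i : ℝ) + 1 ≤ k := by exact_mod_cast hi
  have hkn : (k : ℝ) ≤ n := by exact_mod_cast hk
  have hi0 : (0 : ℝ) ≤ i := i.cast_nonneg
  have he0 : (0 : ℝ) ≤ e := e.cast_nonneg
  push_cast at hδ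
  have hn : 0 < (n : ℝ) := by linarith
  have hni : 0 < (n : ℝ) - i := by linarith
  -- The numerator is at most k(e+k), whereas δ n bounds k(e+1+k). This surplus k pays for n - i in
  -- place of n, because i(e+1+k) ≤ n when δ < 1.
  have hkey : ((i : ℝ) + 1) * (e + i + 1) ≤ δ * (n - i) := by
    have hlt : (k : ℝ) * (e + 1 + k) < n := by nlinarith
    have h1 : ((i : ℝ) + 1) * (e + i + 1) ≤ k * (e + k) := by
      apply mul_le_mul hik _ (by positivity) (by positivity)
      linarith
    have h2 : δ * (n - i) ≥ (k : ℝ) * (e + 1 + k) / n * (n - i) := by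
      apply mul_le_mul_of_nonneg_right _ hni.le
      rwa [div_le_iff₀ hn]
    refine h1.trans (le_trans ?_ h2)
    rw [div_mul_eq_mul_div, le_div_iff₀ hn]
    have h3 : (i : ℝ) * (e + 1 + k) ≤ n := by nlinarith
    have hk0 : (0 : ℝ) ≤ k := by linarith
    nlinarith
  have hf : ((e + (i + 1))! : ℝ) = (e + i + 1) * (e + i)! := by
    rw [← add_assoc, Nat.factorial_succ]; push_cast; ring
  rw [coefB, coefB, hf, div_le_iff₀ (by positivity)]
  have hch : (n.choose i : ℝ) = n.choose (i + 1) * (i + 1) / (n - i) := by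
    rw [hc, mul_div_cancel_right₀ _ hni.ne']
  have : δ * (↑(n.choose (i + 1)) / ((↑e + ↑i + 1) * ((e + i)! : ℝ))) * ((e + i)! : ℝ) =
      δ * n.choose (i + 1) / (e + i + 1) := by field_simp
  rw [this, hch, div_le_div_iff₀ hni (by positivity)]
  have hcc : (0 : ℝ) ≤ n.choose (i + 1) := Nat.cast_nonneg _
  calc (n.choose (i + 1) : ℝ) * (i + 1) * (e + i + 1)
      = n.choose (i + 1) * ((i + 1) * (e + i + 1)) := by ring
    _ ≤ n.choose (i + 1) * (δ * (n - i)) := mul_le_mul_of_nonneg_left hkey hcc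
    _ = _ := by ring

lemma coefB_div_le (hk : k ≤ n) (hδ : (k : ℝ) * ((e + 1 : ℕ) + k) ≤ δ * n) (hδ0 : 0 ≤ δ)
    (hδ1 : δ < 1) {t : ℕ} (ht : t ≤ k) : coefB e n (k - t) / coefB e n k ≤ δ ^ t := by
  rw [div_le_iff₀ (coefB_pos e hk)]
  induction t with
  | zero => simp
  | succ t ih =>
    have h := coefB_le_mul_coefB_succ hk hδ hδ1 (i := k - (t + 1)) (by omega)
    rw [show k - (t + 1) + 1 = k - t by omega] at h
    calc _ ≤ δ * coefB e n (k - t) := h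
      _ ≤ δ * (δ ^ t * coefB e n k) := mul_le_mul_of_nonneg_left (ih (by omega)) hδ0
      _ = _ := by ring

lemma abs_coefG_le (hk : k ≤ n) (hδ : (k : ℝ) * ((e + 1 : ℕ) + k) ≤ δ * n) (hδ0 : 0 ≤ δ)
    (hδ1 : δ < 1) {r t : ℕ} (ht : t ≤ k) : |coefG e n k r t| ≤ if t ≤ r then 0 else δ ^ t := by
  -- At t = 0 the alternating sum is 1 and cancels the leading 1. For t ≥ 1 it is ±C(t-1,r), which
  -- vanishes if t ≤ r and is at most t! otherwise.
  rcases t with _ | t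
  · rw [coefG, Finset.sum_eq_single 0]
    · simp [(coefB_pos e hk).ne']
    · intro s _ hs
      rw [Nat.choose_eq_zero_of_lt (Nat.pos_of_ne_zero hs)]; simp
    · simp
  · rw [coefG, if_neg t.succ_ne_zero, sum_range_neg_one_pow_mul_choose]
    split_ifs with h
    · rw [Nat.choose_eq_zero_of_lt h]; simp
    · have hb : 0 ≤ coefB e n (k - (t + 1)) / coefB e n k :=
        div_nonneg (coefB_pos e (by omega)).le (coefB_pos e hk).le
      rw [zero_sub, abs_neg, abs_mul, abs_mul, abs_pow, abs_neg, abs_one, one_pow, one_mul,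
        abs_of_nonneg (div_nonneg hb (by positivity)), Nat.abs_cast, div_mul_eq_mul_div,
        mul_div_assoc]
      have hc : (t.choose r : ℝ) / (t + 1)! ≤ 1 := by
        rw [div_le_one (by positivity)]
        exact_mod_cast (choose_le_factorial t r).trans (Nat.factorial_le t.le_succ)
      calc _ ≤ coefB e n (k - (t + 1)) / coefB e n k * 1 := mul_le_mul_of_nonneg_left hc hb
        _ ≤ _ := by rw [mul_one]; exact coefB_div_le hk hδ hδ0 hδ1 ht

lemma sum_abs_coefG_le (hk : k ≤ n) (hδ : (k : ℝ) * ((e + 1 : ℕ) + k) ≤ δ * n) (hδ0 : 0 ≤ δ)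
    (hδ3 : 3 * δ < 1) (r : ℕ) :
    ∑ t ∈ Finset.range (k + 1), |coefG e n k r t| ≤ δ ^ r / (1 - 3 * δ) := by
  have hδ1 : δ < 1 := by linarith
  calc ∑ t ∈ Finset.range (k + 1), |coefG e n k r t|
      ≤ ∑ t ∈ Finset.range (k + 1), if t ≤ r then 0 else δ ^ t :=
        Finset.sum_le_sum fun t ht =>
          abs_coefG_le hk hδ hδ0 hδ1 (Nat.lt_succ_iff.mp (Finset.mem_range.mp ht))
    _ = ∑ t ∈ Finset.Ico (r + 1) (k + 1), δ ^ t := by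
        simp only [← ite_not (p := _ ≤ _)]
        rw [← Finset.sum_filter]
        refine Finset.sum_congr ?_ fun _ _ => rfl
        ext t
        simp only [Finset.mem_filter, Finset.mem_range, Finset.mem_Ico]
        omega
    -- This bound is stronger than the stated one, which follows by weakening numerator and
    -- denominator.
    _ ≤ δ ^ (r + 1) / (1 - δ) := geom_sum_Ico_le_of_lt_one hδ0 hδ1
    _ ≤ δ ^ r / (1 - 3 * δ) := by
        apply div_le_div₀ (by positivity) _ (by linarith) (by linarith)
        exact pow_le_pow_of_le_one hδ0 hδ1.le r.le_succ

lemma coefA_succ_le (hδ : (k : ℝ) * ((e + 1 : ℕ) + k) ≤ δ * n) (hδ0 : 0 ≤ δ) {j : ℕ} (hj : j < k) :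
    coefA e n (j + 1) ≤ δ * coefA e n j := by
  have hjk : (j : ℝ) + 1 ≤ k := by exact_mod_cast hj
  have hj0 : (0 : ℝ) ≤ j := j.cast_nonneg
  have he0 : (0 : ℝ) ≤ e := e.cast_nonneg
  have hn0 : (0 : ℝ) ≤ n := n.cast_nonneg
  push_cast at hδ
  have h1 : coefA e n (j + 1) = coefA e n j * ((e + j + 1) * (j + 1) / (e + n + j + 1)) := by
    simp only [coefA, ← add_assoc, Nat.factorial_succ]
    push_cast
    field_simp
  rw [h1, mul_comm δ]
  apply mul_le_mul_of_nonneg_left _ (coefA_pos e n j).le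
  rw [div_le_iff₀ (by positivity)]
  have h2 : ((e : ℝ) + j + 1) * (j + 1) ≤ k * (e + 1 + k) := by
    rw [mul_comm]
    apply mul_le_mul hjk _ (by positivity) (by linarith)
    linarith
  nlinarith [mul_nonneg hδ0 he0, mul_nonneg hδ0 hj0]

lemma coefA_le_pow_mul (hδ : (k : ℝ) * ((e + 1 : ℕ) + k) ≤ δ * n) (hδ0 : 0 ≤ δ) {s : ℕ}
    (hs : s ≤ k) : coefA e n k ≤ δ ^ s * coefA e n (k - s) := by
  induction s with
  | zero => simp
  | succ s ih =>
    have h := coefA_succ_le (n := n) hδ hδ0 (j := k - (s + 1)) (by omega)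
    rw [show k - (s + 1) + 1 = k - s by omega] at h
    calc _ ≤ δ ^ s * coefA e n (k - s) := ih (by omega)
      _ ≤ δ ^ s * (δ * coefA e n (k - (s + 1))) := mul_le_mul_of_nonneg_left h (by positivity)
      _ = _ := by ring

/-- A_j B_j is the weight of tr_{n-j} itself in MP_{n→j}. Its successive ratios are at least 1 -
(e+2j+1)/n, and the increments e+2j+1 add up to j(e+j). -/
lemma one_sub_le_coefA_mul_coefB (hn : 0 < n) {j : ℕ} (hj : j ≤ n) :
    coefA e n j * coefB e n j ≤ 1 ∧ 1 - (j : ℝ) * (e + j) / n ≤ coefA e n j * coefB e n j := by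
  have hn0 : (0 : ℝ) < n := by exact_mod_cast hn
  induction j with
  | zero =>
    have : coefA e n 0 * coefB e n 0 = 1 := by simp [coefA, coefB]; field_simp
    rw [this]; simp
  | succ j ih =>
    obtain ⟨h1, h2⟩ := ih (by omega)
    have hjn : (j : ℝ) + 1 ≤ n := by exact_mod_cast hj
    have hc : (n.choose (j + 1) : ℝ) * (j + 1) = n.choose j * (n - j) := by
      have := Nat.choose_succ_right_eq n j
      rw [← Nat.cast_sub (by omega : j ≤ n)]
      exact_mod_cast this
    have hq : coefA e n (j + 1) * coefB e n (j + 1) =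
        coefA e n j * coefB e n j * ((n - j) / (e + n + j + 1)) := by
      have hc' : (n.choose (j + 1) : ℝ) = n.choose j * (n - j) / (j + 1) := by
        rw [← hc]; field_simp
      simp only [coefA, coefB, ← add_assoc, Nat.factorial_succ, hc']
      push_cast
      field_simp
    have hpos : 0 < coefA e n j * coefB e n j := mul_pos (coefA_pos e n j) (coefB_pos e (by omega))
    have hle : ((n : ℝ) - j) / (e + n + j + 1) ≤ 1 := by
      rw [div_le_one (by positivity)]
      have : (0 : ℝ) ≤ e := e.cast_nonneg
      have : (0 : ℝ) ≤ j := j.cast_nonneg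
      linarith
    have hge : 1 - ((e : ℝ) + 2 * j + 1) / n ≤ ((n : ℝ) - j) / (e + n + j + 1) := by
      rw [sub_le_iff_le_add, ← sub_le_iff_le_add']
      have h3 : 1 - ((n : ℝ) - j) / (e + n + j + 1) = (e + 2 * j + 1) / (e + n + j + 1) := by
        field_simp; ring
      rw [h3]
      apply div_le_div_of_nonneg_left (by positivity) hn0
      have : (0 : ℝ) ≤ e := e.cast_nonneg
      have : (0 : ℝ) ≤ j := j.cast_nonneg
      linarith
    rw [hq]
    refine ⟨mul_le_one₀ h1 (div_nonneg (by linarith) (by positivity)) hle, ?_⟩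
    have h4 : coefA e n j * coefB e n j * (((e : ℝ) + 2 * j + 1) / n) ≤ (e + 2 * j + 1) / n :=
      mul_le_of_le_one_left (by positivity) h1
    have h5 : ((j + 1 : ℕ) : ℝ) * (e + (j + 1 : ℕ)) / n =
        (j : ℝ) * (e + j) / n + (e + 2 * j + 1) / n := by
      push_cast; ring
    rw [h5]
    nlinarith [mul_le_mul_of_nonneg_left hge hpos.le]

/-- Moving from A_{k-s} to A_k gains δ^s, and A_k B_k ≥ 1 - δ. The factors s! and 2^s are slack. -/
lemma abs_coefX_le (hn : 0 < n) (hk : k ≤ n) (hδ : (k : ℝ) * ((e + 1 : ℕ) + k) ≤ δ * n)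
    (hδ0 : 0 ≤ δ) (hδ1 : δ < 1) {s : ℕ} (hs : s ≤ k) :
    |coefX e n k s| ≤ (2 * δ) ^ s / (1 - δ) := by
  have ha := coefA_pos e n (k - s)
  have hb := coefB_pos e hk
  have hn0 : (0 : ℝ) < n := by exact_mod_cast hn
  have h1 : 1 - δ ≤ coefA e n k * coefB e n k := by
    refine le_trans ?_ (one_sub_le_coefA_mul_coefB hn hk).2
    have : (k : ℝ) * (e + k) / n ≤ δ := by
      rw [div_le_iff₀ hn0]
      refine le_trans ?_ hδ
      push_cast
      have : (0 : ℝ) ≤ k := k.cast_nonneg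
      nlinarith
    linarith
  have h2 := coefA_le_pow_mul (n := n) hδ hδ0 hs
  have hs1 : (1 : ℝ) ≤ s ! := by exact_mod_cast s.factorial_pos
  rw [coefX, abs_div, abs_pow, abs_neg, abs_one, one_pow, abs_of_pos (by positivity),
    div_le_div_iff₀ (by positivity) (by linarith), one_mul]
  have h3 : δ ^ s ≤ (2 * δ) ^ s := pow_le_pow_left₀ hδ0 (by linarith) s
  calc 1 - δ ≤ coefA e n k * coefB e n k := h1
    _ ≤ δ ^ s * coefA e n (k - s) * coefB e n k := mul_le_mul_of_nonneg_right h2 hb.le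
    _ ≤ (2 * δ) ^ s * coefA e n (k - s) * coefB e n k := by gcongr
    _ ≤ (2 * δ) ^ s * (s ! * coefA e n (k - s) * coefB e n k) := by
        rw [mul_assoc]
        apply mul_le_mul_of_nonneg_left _ (by positivity)
        rw [mul_assoc]
        exact le_mul_of_one_le_left (by positivity) hs1

end Bounds

end ExpDeFinetti

end

/-! ### The expansion with remainder, and the diamond norm. -/

noncomputable section

namespace ExpDeFinetti

open Matrix

/-- The operators on the symmetric subspace. -/
def symOps (d n : ℕ) : Submodule ℂ (Op d n) where
  carrier := {X | symProj d n * X * symProj d n = X}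
  add_mem' {X Y} hX hY := by
    change _ * (X + Y) * _ = _
    rw [mul_add, add_mul, hX, hY]
  zero_mem' := by
    change _ * (0 : Op d n) * _ = _
    rw [mul_zero, zero_mul]
  smul_mem' c X hX := by
    change _ * (c • X) * _ = _
    rw [mul_smul_comm, smul_mul_assoc, hX]

lemma vecMulVec_tpow_mem_symOps {d n : ℕ} (α β : Fin d → ℂ) :
    vecMulVec (tpow n α) (tpow n β) ∈ symOps d n := by
  change symProj d n * _ * symProj d n = _
  rw [mul_vecMulVec, vecMulVec_mul, symProj_mulVec_tpow, tpow_vecMul_symProj]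

/-- The de Finetti expansion of the partial trace with its remainder. -/
lemma traceLast_sub_sum_eq {e n k r : ℕ} (hk : k ≤ n) (hr : r ≤ k) {ρ : Op (e + 1) n}
    (hρ : symProj (e + 1) n * ρ * symProj (e + 1) n = ρ) :
    (traceLast (e + 1) (Nat.add_sub_of_le hk : k + (n - k) = n) -
      ∑ s : Fin (r + 1), ((coefX e n k s : ℝ) : ℂ) •
        (Clone (e + 1) (Nat.sub_add_cancel ((Nat.le_of_lt_succ s.isLt).trans hr) :
          k - (s : ℕ) + (s : ℕ) = k) ∘ₗ MP (e + 1) n (k - (s : ℕ)))) ρ =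
    ∑ t : Fin (k + 1), ((coefG e n k r t : ℝ) : ℂ) •
      (Clone (e + 1) (Nat.sub_add_cancel (Nat.le_of_lt_succ t.isLt) : k - (t : ℕ) + (t : ℕ) = k) ∘ₗ
        traceLast (e + 1) (Nat.add_sub_of_le ((Nat.sub_le _ _).trans hk) :
          k - (t : ℕ) + (n - (k - (t : ℕ))) = n)) ρ := by
  have hd : 0 < e + 1 := e.succ_pos
  simp only [← LinearMap.smul_apply]
  rw [← LinearMap.sum_apply]
  -- Both sides are linear in ρ, so inputs |α^{⊗n}⟩⟨β^{⊗n}| suffice. Both outputs live on the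
  -- symmetric subspace, so elements between tensor powers suffice.
  refine LinearMap.eqOn_span' ?_ (mem_span_tpow hρ)
  rintro _ ⟨⟨α, β⟩, rfl⟩
  simp only [LinearMap.sub_apply, LinearMap.sum_apply, LinearMap.smul_apply, LinearMap.comp_apply]
  refine ext_of_tpow ?_ ?_ fun v w => ?_
  · refine (symOps (e + 1) k).sub_mem ?_ ((symOps (e + 1) k).sum_mem fun s _ =>
      (symOps (e + 1) k).smul_mem _ (symProj_mul_Clone_mul_symProj _ _))
    rw [traceLast_vecMulVec_tpow]
    exact (symOps (e + 1) k).smul_mem _ (vecMulVec_tpow_mem_symOps _ _)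
  · exact (symOps (e + 1) k).sum_mem fun s _ =>
      (symOps (e + 1) k).smul_mem _ (symProj_mul_Clone_mul_symProj _ _)
  set z : ℕ → ℂ := fun u =>
    (β ⬝ᵥ α) ^ (n - u) * (v ⬝ᵥ α) ^ u * (β ⬝ᵥ w) ^ u * (v ⬝ᵥ w) ^ (k - u)
  have hpair : ∀ i : ℕ, tpow i v ⬝ᵥ vecMulVec (tpow i α) (tpow i β) *ᵥ tpow i w =
      (v ⬝ᵥ α) ^ i * (β ⬝ᵥ w) ^ i := by
    intro i
    rw [vecMulVec_mulVec, op_smul_eq_smul, dotProduct_smul, tpow_dotProduct_tpow,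
      tpow_dotProduct_tpow, smul_eq_mul, mul_comm]
  have hk0 := symDim_ne_zero hd k
  have htr : tpow k v ⬝ᵥ traceLast (e + 1) (Nat.add_sub_of_le hk : k + (n - k) = n)
      (vecMulVec (tpow n α) (tpow n β)) *ᵥ tpow k w = z k := by
    rw [traceLast_vecMulVec_tpow, smul_mulVec, dotProduct_smul, hpair, smul_eq_mul]
    simp only [z, Nat.sub_self, pow_zero]
    ring
  have hMP : ∀ s : Fin (r + 1), tpow k v ⬝ᵥ Clone (e + 1)
      (Nat.sub_add_cancel ((Nat.le_of_lt_succ s.isLt).trans hr) : k - (s : ℕ) + (s : ℕ) = k)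
        (MP (e + 1) n (k - (s : ℕ)) (vecMulVec (tpow n α) (tpow n β))) *ᵥ tpow k w =
      (symDim (e + 1) k : ℂ)⁻¹ * ∑ u ∈ Finset.range (k + 1),
        ((symDim (e + 1) (k - s) : ℂ) * symDim (e + 1) n /
      (symDim (e + 1) (n + (k - s)) * (n + (k - s)).choose (k - s)) *
        (n.choose u * (k - s).choose u)) * z u := by
    intro s
    have hs : (s : ℕ) ≤ k := (Nat.le_of_lt_succ s.isLt).trans hr
    rw [dotProduct_Clone_mulVec, dotProduct_MP_mulVec hd]
    -- The range of u is extended from k - s to k, where the new binomials vanish, so that it no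
    -- longer depends on s and the two sums can be exchanged.
    have hsum : ∑ u ∈ Finset.range (k + 1), ((symDim (e + 1) (k - s) : ℂ) * symDim (e + 1) n /
      (symDim (e + 1) (n + (k - s)) * (n + (k - s)).choose (k - s)) *
        (n.choose u * (k - s).choose u)) * z u =
        ∑ u ∈ Finset.range (k - s + 1), ((symDim (e + 1) (k - s) : ℂ) * symDim (e + 1) n /
      (symDim (e + 1) (n + (k - s)) * (n + (k - s)).choose (k - s)) *
        (n.choose u * (k - s).choose u)) * z u := by
      symm
      refine Finset.sum_subset (fun u hu => ?_) fun u _ hu => ?_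
      · rw [Finset.mem_range] at hu ⊢; omega
      · rw [Finset.mem_range, not_lt] at hu
        rw [Nat.choose_eq_zero_of_lt (by omega : k - (s : ℕ) < u)]
        simp
    rw [hsum]
    simp only [Finset.mul_sum]
    refine Finset.sum_congr rfl fun u hu => ?_
    have hu' : u ≤ k - s := Nat.lt_succ_iff.mp (Finset.mem_range.mp hu)
    have hz : z u = (β ⬝ᵥ α) ^ (n - u) * (v ⬝ᵥ α) ^ u * (β ⬝ᵥ w) ^ u *
        ((v ⬝ᵥ w) ^ (k - s - u) * (v ⬝ᵥ w) ^ (s : ℕ)) := by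
      rw [← pow_add, show k - s - u + s = k - u by omega]
    rw [hz]
    simp only [div_eq_mul_inv, mul_inv]
    ring
  have hT : ∀ t : Fin (k + 1), tpow k v ⬝ᵥ Clone (e + 1)
      (Nat.sub_add_cancel (Nat.le_of_lt_succ t.isLt) : k - (t : ℕ) + (t : ℕ) = k)
        (traceLast (e + 1) (Nat.add_sub_of_le ((Nat.sub_le _ _).trans hk) :
          k - (t : ℕ) + (n - (k - (t : ℕ))) = n) (vecMulVec (tpow n α) (tpow n β))) *ᵥ tpow k w =
      (symDim (e + 1) k : ℂ)⁻¹ * (symDim (e + 1) (k - t) * z (k - t)) := by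
    intro t
    have ht : (t : ℕ) ≤ k := Nat.le_of_lt_succ t.isLt
    rw [dotProduct_Clone_mulVec, traceLast_vecMulVec_tpow, smul_mulVec, dotProduct_smul, hpair,
      smul_eq_mul]
    simp only [z, Nat.sub_sub_self ht, div_eq_mul_inv]
    ring
  rw [sub_mulVec, dotProduct_sub, sum_mulVec, dotProduct_sum, sum_mulVec, dotProduct_sum, htr]
  simp only [smul_mulVec, dotProduct_smul, smul_eq_mul, hMP, hT]
  rw [Fin.sum_univ_eq_sum_range (fun s => ((coefX e n k s : ℝ) : ℂ) * ((symDim (e + 1) k : ℂ)⁻¹ *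
      ∑ u ∈ Finset.range (k + 1), ((symDim (e + 1) (k - s) : ℂ) * symDim (e + 1) n /
      (symDim (e + 1) (n + (k - s)) * (n + (k - s)).choose (k - s)) *
        (n.choose u * (k - s).choose u)) * z u)),
    Fin.sum_univ_eq_sum_range (fun t => ((coefG e n k r t : ℝ) : ℂ) * ((symDim (e + 1) k : ℂ)⁻¹ *
      (symDim (e + 1) (k - t) * z (k - t)))),
    ← Finset.sum_range_reflect _ (k + 1)]
  apply mul_left_cancel₀ hk0
  have hlast : (symDim (e + 1) k : ℂ) * z k =
      ∑ u ∈ Finset.range (k + 1), (if u = k then (symDim (e + 1) k : ℂ) else 0) * z u := by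
    simp only [ite_mul, zero_mul]
    rw [Finset.sum_ite_eq', if_pos (Finset.self_mem_range_succ k)]
  have hmid : (symDim (e + 1) k : ℂ) * ∑ s ∈ Finset.range (r + 1), ((coefX e n k s : ℝ) : ℂ) *
      ((symDim (e + 1) k : ℂ)⁻¹ *
      ∑ u ∈ Finset.range (k + 1), ((symDim (e + 1) (k - s) : ℂ) * symDim (e + 1) n /
      (symDim (e + 1) (n + (k - s)) * (n + (k - s)).choose (k - s)) *
        (n.choose u * (k - s).choose u)) * z u) =
      ∑ u ∈ Finset.range (k + 1), (∑ s ∈ Finset.range (r + 1), ((coefX e n k s : ℝ) : ℂ) *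
        ((symDim (e + 1) (k - s) : ℂ) * symDim (e + 1) n /
      (symDim (e + 1) (n + (k - s)) * (n + (k - s)).choose (k - s)) *
        (n.choose u * (k - s).choose u))) * z u := by
    simp only [Finset.sum_mul]
    rw [Finset.sum_comm, Finset.mul_sum]
    refine Finset.sum_congr rfl fun s _ => ?_
    rw [mul_left_comm, mul_inv_cancel_left₀ hk0, Finset.mul_sum]
    exact Finset.sum_congr rfl fun u _ => (mul_assoc _ _ _).symm
  rw [mul_sub, hlast, hmid, ← Finset.sum_sub_distrib, Finset.mul_sum]
  refine Finset.sum_congr rfl fun u hu => ?_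
  have huk : u ≤ k := Nat.lt_succ_iff.mp (Finset.mem_range.mp hu)
  have h := congrArg (fun x : ℝ => (x : ℂ)) (coefG_mul_symDim e n hk hr huk)
  push_cast [apply_ite Complex.ofReal] at h
  rw [← sub_mul, h, Nat.add_sub_cancel, Nat.sub_sub_self huk]
  generalize z u = y
  field_simp

/-- Amplification acts on the blocks of X indexed by the reference system. Each block is again an
operator on the range of P, so an identity valid only there can be applied to it. -/
lemma mul_block_mul_of_kronecker {ι : Type*} [Fintype ι] [DecidableEq ι] {P : Matrix ι ι ℂ}
    {m : ℕ} {X : Matrix (ι × Fin m) (ι × Fin m) ℂ}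
    (hX : (P ⊗ₖ (1 : Matrix (Fin m) (Fin m) ℂ)) * X * (P ⊗ₖ (1 : Matrix (Fin m) (Fin m) ℂ)) = X)
    (p q : Fin m) : P * (of fun i j => X (i, p) (j, q)) * P = of fun i j => X (i, p) (j, q) := by
  ext i j
  conv_rhs => rw [of_apply, ← hX]
  simp only [mul_apply, Fintype.sum_prod_type, kroneckerMap_apply, one_apply, mul_ite, mul_one,
    mul_zero, ite_mul, zero_mul, Finset.sum_ite_eq, Finset.sum_ite_eq', Finset.mem_univ, if_true,
    of_apply]

/-- If a map agrees with a combination of trace-norm contractions on the operators on a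
subspace, then its diamond norm on that subspace is at most the sum of the absolute values of
the coefficients. -/
lemma diamondNormOn_le {ι κ : Type*} [Fintype ι] [DecidableEq ι] [Fintype κ] [DecidableEq κ]
    {P : Matrix ι ι ℂ} {Φ : Matrix ι ι ℂ →ₗ[ℂ] Matrix κ κ ℂ} {T : Type*} [Fintype T]
    (c : T → ℂ) (Ψ : T → Matrix ι ι ℂ →ₗ[ℂ] Matrix κ κ ℂ)
    (hΦ : ∀ ρ, P * ρ * P = ρ → Φ ρ = ∑ t, c t • Ψ t ρ)
    (hΨ : ∀ t m X, traceNorm (ampliate (Ψ t) m X) ≤ traceNorm X) :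
    diamondNormOn P Φ ≤ ENNReal.ofReal (∑ t, ‖c t‖) := by
  refine iSup_le fun m => iSup_le fun X => iSup_le fun hX => iSup_le fun h1 =>
    ENNReal.ofReal_le_ofReal ?_
  have h : ampliate Φ m X = ∑ t, c t • ampliate (Ψ t) m X := by
    ext p q
    rw [ampliate, of_apply, hΦ _ (mul_block_mul_of_kronecker hX p.2 q.2), Matrix.sum_apply,
      Matrix.sum_apply]
    rfl
  rw [h]
  refine (traceNorm_sum_smul_le _ _).trans (Finset.sum_le_sum fun t _ => ?_)
  exact mul_le_of_le_one_right (norm_nonneg _) ((hΨ t m X).trans h1)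

end ExpDeFinetti

end

theorem mainTheorem1 (d n k r : ℕ) (hd : 0 < d) (hn : 0 < n) (hkn : k ≤ n) (hr : r ≤ k)
    (δ : ℝ) (hδ : δ = (k : ℝ) * ((d : ℝ) + (k : ℝ)) / (n : ℝ)) (hδ_lt : 3 * δ < 1) :
    ∃ x : Fin (r + 1) → ℝ,
      (∀ s : Fin (r + 1), |x s| ≤ (2 * δ) ^ (s : ℕ) / (1 - δ)) ∧
      ExpDeFinetti.diamondNormOn (ExpDeFinetti.symProj d n)
          (ExpDeFinetti.traceLast d (Nat.add_sub_of_le hkn : k + (n - k) = n) -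
            ∑ s : Fin (r + 1), ((x s : ℝ) : ℂ) •
              (ExpDeFinetti.Clone d
                  (Nat.sub_add_cancel ((Nat.le_of_lt_succ s.isLt).trans hr) :
                    k - (s : ℕ) + (s : ℕ) = k) ∘ₗ
                ExpDeFinetti.MP d n (k - (s : ℕ)))) ≤
        ENNReal.ofReal (δ ^ r / (1 - 3 * δ)) := by
  -- With d = e + 1 the dimension d[m] is (e+m)!/(e! m!), free of truncated subtraction.
  obtain ⟨e, rfl⟩ : ∃ e, d = e + 1 := ⟨d - 1, by omega⟩
  have hn0 : (0 : ℝ) < n := by exact_mod_cast hn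
  have hδn : (k : ℝ) * ((e + 1 : ℕ) + k) ≤ δ * n := by
    rw [hδ, div_mul_cancel₀ _ hn0.ne']
  have hδ0 : 0 ≤ δ := by rw [hδ]; positivity
  refine ⟨fun s => ExpDeFinetti.coefX e n k s, fun s => ExpDeFinetti.abs_coefX_le hn hkn hδn hδ0
    (by linarith) ((Nat.le_of_lt_succ s.isLt).trans hr), ?_⟩
  refine (ExpDeFinetti.diamondNormOn_le
    (fun t : Fin (k + 1) => ((ExpDeFinetti.coefG e n k r t : ℝ) : ℂ)) _
    (fun ρ hρ => ExpDeFinetti.traceLast_sub_sum_eq hkn hr hρ) fun t m X => ?_).trans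
    (ENNReal.ofReal_le_ofReal ?_)
  · rw [ExpDeFinetti.ampliate_comp]
    exact (ExpDeFinetti.traceNorm_ampliate_Clone_le hd _ m _).trans
      (ExpDeFinetti.traceNorm_ampliate_traceLast_le _ m X)
  · simp only [Complex.norm_real, Real.norm_eq_abs]
    rw [Fin.sum_univ_eq_sum_range (fun t => |ExpDeFinetti.coefG e n k r t|)]
    exact ExpDeFinetti.sum_abs_coefG_le hkn hδn hδ0 hδ_lt r
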